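/- Let $\mathcal P_2=\{(x,y)\in\mathbb R^2 : |y|\le 1-x^2\}$, let $|\mathcal P_2|$ denote its area, and for $R>0$ let $\mathcal N_2(R)=\#\{n\in\mathbb Z^2 : R^{-1}n\in\mathcal P_2\}$ be the number of lattice points in $\mathcal P_2$ scaled by $R$. Then for every squarefree positive integer $N$, $$\mathcal N_2(N)-|\mathcal P_2|\,N^2=\frac73-4\sum_{\substack{d\mid N\\ d\equiv 3\ (\mathrm{mod}\ 4)}}\omega_d\,h(-d),$$ where $d$ runs over the positive divisors of $N$ congruent to $3$ modulo $4$, $h(-d)$ is the class number of the ring of integers of $\mathbb Q(\sqrt{-d})$, $\omega_3=1/3$, and $\omega_d=1$ for $d\neq 3$. -/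

import Mathlib

noncomputable section

/-- The plane parabolic region `|y| ≤ 1 - x²`. -/
def parabolicRegion : Set (ℝ × ℝ) :=
  {p | |p.2| ≤ 1 - p.1 ^ 2}

/-- The number of lattice points `n ∈ ℤ²` such that `R⁻¹ n` lies in the plane set `K`,
i.e. of lattice points in `K` scaled by `R` (for `R > 0`). -/
def latticePointCount (K : Set (ℝ × ℝ)) (R : ℝ) : ℕ :=
  {n : ℤ × ℤ | R⁻¹ • ((n.1 : ℝ), (n.2 : ℝ)) ∈ K}.ncard

/-- The complex number `√(-d)`, for a natural number `d`. -/
def sqrtNeg (d : ℕ) : ℂ := Complex.I * (Real.sqrt d : ℂ)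

theorem sqrtNeg_sq (d : ℕ) : sqrtNeg d ^ 2 = -(d : ℂ) := by
  have h : ((Real.sqrt d : ℝ) : ℂ) ^ 2 = (d : ℂ) := by
    rw [← Complex.ofReal_pow, Real.sq_sqrt (Nat.cast_nonneg d), Complex.ofReal_natCast]
  rw [sqrtNeg, mul_pow, Complex.I_sq, h, neg_one_mul]

theorem isIntegral_sqrtNeg (d : ℕ) : IsIntegral ℚ (sqrtNeg d) := by
  refine IsIntegral.of_pow (n := 2) (by norm_num) ?_
  rw [sqrtNeg_sq]
  have h := isIntegral_algebraMap (R := ℚ) (A := ℂ) (x := -(d : ℚ))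
  simpa using h

/-- The field `ℚ(√(-d))`, as a subfield of `ℂ`. -/
abbrev imaginaryQuadraticField (d : ℕ) : IntermediateField ℚ ℂ :=
  IntermediateField.adjoin ℚ {sqrtNeg d}

instance instNumberFieldImaginaryQuadraticField (d : ℕ) :
    NumberField (imaginaryQuadraticField d) where
  to_charZero := inferInstance
  to_finiteDimensional := IntermediateField.adjoin.finiteDimensional (isIntegral_sqrtNeg d)

/-- `h(-d)`: the class number of the ring of integers of `ℚ(√(-d))`. -/
def classNumberNeg (d : ℕ) : ℕ :=
  NumberField.classNumber (imaginaryQuadraticField d)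

/-- The weight `ω_d`, equal to `1/3` for `d = 3` and to `1` otherwise. -/
def classWeight (d : ℕ) : ℝ :=
  if d = 3 then 1 / 3 else 1

end

/-! On the column with abscissa `m`, `|m| ≤ N`, the scaled region contains `2⌊(N² - m²)/N⌋ + 1`
lattice points. Replacing each floor by its remainder reduces the count to a polynomial in `N` and
the sum of the residues of `-a²` modulo `N` (`mul_latticePointCount_parabolicRegion`).

For squarefree `N`, the number of square roots of `a` modulo `N` is the sum of `J(a | e)` over odd
`e ∣ N` (`card_sqrt_eq_sum`), so the residue sum splits over the divisors `e`. The term `e = 1`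
gives the main part `N(N - 1)/2`. Terms with `e ≡ 1` mod 4, `e ≠ 1`, vanish because the character is
even. Terms with `e ≡ 3` mod 4 are multiples of `∑ b J(b | e)` (`sum_val_neg_sq`).

There remains Dirichlet's formula `∑ b J(b | d) = -d ω_d h(-d)` for squarefree `d ≡ 3` mod 4. It
comes from two evaluations of `L(1, χ)`, with `χ = J(· | d)`. On one side, `L(1, χ)` is a sum of
cotangents; their finite Fourier expansion and the Gauss sum `i√d` turn it into `-(π√d/d²) ∑ b J(b |
d)` (`LFunction_jacobiChar_one`). The sign of the Gauss sum is settled by the asymptotics of a theta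
series on both sides of Poisson summation (`sum_exp_sq_eq`).

On the other side, the number of ideals of norm `n` in the ring of integers of `ℚ(√(-d))` is `∑_{m ∣
n} J(m | d)` (`idealCount_imaginaryQuadraticField`). Hence the Dedekind zeta function is `ζ(s) L(s,
χ)`, and `L(1, χ)` is its residue at `1`, which the analytic class number formula gives as `(π/√d)
ω_d h(-d)`. The weight is `ω_d = 2/w`, with `w` the number of roots of unity. -/

open scoped NumberTheorySymbols ArithmeticFunction.zeta

/-! ### The Jacobi symbol as a character -/

section JacobiCharacter

/-- The Jacobi symbol `a ↦ J(a | d)` as an integer valued multiplicative character modulo `d`. -/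
def jacobiMulChar (d : ℕ) [NeZero d] : MulChar (ZMod d) ℤ where
  toFun x := J((x.cast : ℤ) | d)
  map_one' := by
    rw [jacobiSym.mod_left' (a₂ := 1), jacobiSym.one_left]
    exact (ZMod.intCast_eq_intCast_iff' _ _ _).1 (by simp)
  map_mul' x y := by
    rw [← jacobiSym.mul_left]
    exact jacobiSym.mod_left' ((ZMod.intCast_eq_intCast_iff' _ _ _).1 (by simp))
  map_nonunit' x hx := by
    refine jacobiSym.eq_zero_iff_not_coprime.2 fun h => hx ?_
    have h' : IsCoprime (x.cast : ℤ) (d : ℤ) := Int.isCoprime_iff_gcd_eq_one.2 h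
    have := (ZMod.coe_int_isUnit_iff_isCoprime (x.cast : ℤ) d).2 h'.symm
    simpa using this

theorem jacobiMulChar_intCast (d : ℕ) [NeZero d] (a : ℤ) :
    jacobiMulChar d (a : ZMod d) = J(a | d) :=
  jacobiSym.mod_left' ((ZMod.intCast_eq_intCast_iff' _ _ _).1 (by simp))

theorem jacobiMulChar_natCast (d : ℕ) [NeZero d] (a : ℕ) :
    jacobiMulChar d (a : ZMod d) = J(a | d) := by
  simpa using jacobiMulChar_intCast d (a : ℤ)

theorem jacobiMulChar_neg (d : ℕ) [NeZero d] (hd : Odd d) (x : ZMod d) :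
    jacobiMulChar d (-x) = ZMod.χ₄ d * jacobiMulChar d x := by
  obtain ⟨a, rfl⟩ := ZMod.intCast_surjective x
  rw [← Int.cast_neg, jacobiMulChar_intCast, jacobiMulChar_intCast, jacobiSym.neg _ hd]

/-- For `d` odd and squarefree and `p ∣ d` prime there is `u ≡ 1` modulo `d / p` with
`J(u | d) = -1`. -/
theorem exists_jacobiSym_eq_neg_one {p m : ℕ} (hp : p.Prime) (h2 : p ≠ 2) (hm : m ≠ 0)
    (h : p.Coprime m) :
    ∃ u : ℕ, J(u | p * m) = -1 ∧ u ≡ 1 [MOD m] := by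
  have := Fact.mk hp
  obtain ⟨v, hv⟩ := FiniteField.exists_nonsquare (F := ZMod p) (by rwa [ZMod.ringChar_zmod_n])
  obtain ⟨u, hu1, hu2⟩ := Nat.chineseRemainder h v.val 1
  refine ⟨u, ?_, hu2⟩
  have e1 : J(u | p) = -1 := by
    refine (ZMod.nonsquare_iff_jacobiSym_eq_neg_one (p := p)).2 ?_
    have : ((u : ℤ) : ZMod p) = v := by
      have := (ZMod.natCast_eq_natCast_iff _ _ _).2 hu1
      simpa using this
    rwa [this]
  have e2 : J(u | m) = 1 := by
    rw [← jacobiSym.one_left m]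
    apply jacobiSym.mod_left'
    exact_mod_cast hu2
  rw [jacobiSym.mul_right' _ hp.ne_zero hm, e1, e2, mul_one]

theorem jacobiMulChar_ne_one {d : ℕ} [NeZero d] (hodd : Odd d) (hd : Squarefree d) (h1 : d ≠ 1) :
    jacobiMulChar d ≠ 1 := by
  obtain ⟨p, hp, m, rfl⟩ := Nat.exists_prime_and_dvd h1
  have hm : m ≠ 0 := fun h => by simp [h] at hodd
  have h2 : p ≠ 2 := by
    rintro rfl
    exact absurd hodd (by simp)
  obtain ⟨u, hu, -⟩ := exists_jacobiSym_eq_neg_one hp h2 hm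
    (Nat.coprime_of_squarefree_mul hd)
  intro h
  have h' := jacobiMulChar_natCast (p * m) u
  rw [hu, h] at h'
  by_cases hx : IsUnit ((u : ℕ) : ZMod (p * m))
  · rw [MulChar.one_apply hx] at h'
    omega
  · rw [MulChar.map_nonunit _ hx] at h'
    omega

theorem jacobiMulChar_sum_eq_zero {d : ℕ} [NeZero d] (hodd : Odd d) (hd : Squarefree d)
    (h1 : d ≠ 1) : ∑ x : ZMod d, jacobiMulChar d x = 0 :=
  MulChar.sum_eq_zero_of_ne_one (jacobiMulChar_ne_one hodd hd h1)

end JacobiCharacter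

/-! ### Square roots modulo a squarefree number and sums of residues -/

section SquareRoots

open ArithmeticFunction

theorem card_sqrt_mul {m n : ℕ} (h : m.Coprime n) (a : ℤ) :
    Nat.card {x : ZMod (m * n) // x ^ 2 = a} =
      Nat.card {x : ZMod m // x ^ 2 = a} * Nat.card {x : ZMod n // x ^ 2 = a} := by
  rw [← Nat.card_prod]
  refine Nat.card_congr (((ZMod.chineseRemainder h).toEquiv.subtypeEquiv fun x => ?_).trans
    (Equiv.subtypeProdEquivProd (p := fun x : ZMod m => x ^ 2 = a)
      (q := fun x : ZMod n => x ^ 2 = a)))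
  rw [← (ZMod.chineseRemainder h).injective.eq_iff, map_pow, map_intCast, Prod.ext_iff]
  rfl

/-- The arithmetic function equal to `J(a | e)` at odd `e` and to `0` at even `e`. -/
def jacobiOdd (a : ℤ) : ArithmeticFunction ℤ :=
  ⟨fun e => if Odd e then J(a | e) else 0, by simp⟩

theorem jacobiOdd_apply (a : ℤ) (e : ℕ) : jacobiOdd a e = if Odd e then J(a | e) else 0 := rfl

theorem jacobiOdd_isMultiplicative (a : ℤ) : (jacobiOdd a).IsMultiplicative := by
  refine IsMultiplicative.iff_ne_zero.2 ⟨by simp [jacobiOdd_apply], fun hm hn _ => ?_⟩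
  simp only [jacobiOdd_apply, Nat.odd_mul, jacobiSym.mul_right' a hm hn]
  split_ifs <;> simp_all

theorem card_sqrt_prime {p : ℕ} (hp : p.Prime) (a : ℤ) :
    (Nat.card {x : ZMod p // x ^ 2 = a} : ℤ) = ((ζ : ArithmeticFunction ℤ) * jacobiOdd a) p := by
  rw [coe_zeta_mul_apply, hp.sum_divisors]
  rcases eq_or_ne p 2 with rfl | h2
  · have : Nat.card {x : ZMod 2 // x ^ 2 = (a : ZMod 2)} = 1 := by
      generalize (a : ZMod 2) = b
      rw [Nat.card_eq_fintype_card]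
      revert b
      decide
    rw [this]
    simp [jacobiOdd_apply]
  · have := Fact.mk hp
    have h := legendreSym.card_sqrts p h2 a
    have hodd := hp.odd_of_ne_two h2
    rw [jacobiOdd_apply, jacobiOdd_apply, if_pos hodd, if_pos odd_one, jacobiSym.one_right,
      ← jacobiSym.legendreSym.to_jacobiSym, ← h, Nat.card_eq_fintype_card, Fintype.card_subtype]
    congr 2
    ext x
    simp

/-- Both sides are multiplicative over coprime factors, so it suffices to treat primes. An odd `p`
gives `1 + J(a | p)` roots; `p = 2` always gives one, which is why even divisors are discarded. -/
theorem card_sqrt_eq_sum {N : ℕ} (hN : Squarefree N) (a : ℤ) :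
    (Nat.card {x : ZMod N // x ^ 2 = a} : ℤ) = ∑ e ∈ N.divisors with Odd e, J(a | e) := by
  have key : (Nat.card {x : ZMod N // x ^ 2 = a} : ℤ) =
      ((ζ : ArithmeticFunction ℤ) * jacobiOdd a) N := by
    have hmul : ((ζ : ArithmeticFunction ℤ) * jacobiOdd a).IsMultiplicative :=
      isMultiplicative_zeta.natCast.mul (jacobiOdd_isMultiplicative a)
    induction N using induction_on_primes with
    | zero => exact absurd hN not_squarefree_zero
    | one =>
      rw [hmul.map_one]
      have : Subsingleton (ZMod 1) := inferInstanceAs (Subsingleton (Fin 1))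
      have : Unique {x : ZMod 1 // x ^ 2 = (a : ZMod 1)} :=
        ⟨⟨⟨0, Subsingleton.elim _ _⟩⟩, fun y => Subsingleton.elim _ _⟩
      simp
    | prime_mul p n hp ih =>
      have hc := Nat.coprime_of_squarefree_mul hN
      rw [card_sqrt_mul hc, hmul.map_mul_of_coprime hc, Nat.cast_mul,
        ih (hN.squarefree_of_dvd (dvd_mul_left _ _)), card_sqrt_prime hp]
  rw [key, coe_zeta_mul_apply, Finset.sum_filter]
  rfl

theorem sum_zmod_eq_sum_range {R : Type*} [AddCommMonoid R] {N : ℕ} [NeZero N] (f : ZMod N → R) :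
    ∑ x : ZMod N, f x = ∑ a ∈ Finset.range N, f a := by
  refine Finset.sum_bij' (fun x _ => x.val) (fun a _ => (a : ZMod N)) ?_ ?_ ?_ ?_ ?_
  · exact fun x _ => Finset.mem_range.2 x.val_lt
  · simp
  · simp
  · exact fun a ha => ZMod.val_cast_of_lt (Finset.mem_range.1 ha)
  · simp

theorem sum_range_mul_eq {R : Type*} [AddCommMonoid R] (f : ℕ → R) (e t : ℕ) :
    ∑ a ∈ Finset.range (e * t), f a =
      ∑ b ∈ Finset.range e, ∑ i ∈ Finset.range t, f (b + e * i) := by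
  rw [Finset.sum_comm]
  induction t with
  | zero => simp
  | succ t ih => rw [mul_add_one, Finset.sum_range_add, ih, Finset.sum_range_succ]; simp [add_comm]

/-- Sum of a function over the squares modulo a squarefree `N`. -/
theorem sum_sq_zmod {R : Type*} [CommRing R] {N : ℕ} [NeZero N] (hN : Squarefree N)
    (F : ZMod N → R) :
    ∑ x : ZMod N, F (x ^ 2) =
      ∑ e ∈ N.divisors with Odd e, ∑ a ∈ Finset.range N, (J(a | e) : R) * F a := by
  have h1 : ∑ x : ZMod N, F (x ^ 2) =
      ∑ a : ZMod N, (Nat.card {x : ZMod N // x ^ 2 = a} : R) * F a := by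
    rw [← Finset.sum_fiberwise (s := Finset.univ) (g := fun x : ZMod N => x ^ 2)]
    refine Finset.sum_congr rfl fun a _ => ?_
    rw [Finset.sum_congr rfl (g := fun _ => F a) (fun x hx => by rw [(Finset.mem_filter.1 hx).2]),
      Finset.sum_const, nsmul_eq_mul, Nat.card_eq_fintype_card, Fintype.card_subtype]
  rw [h1, sum_zmod_eq_sum_range, Finset.sum_comm]
  refine Finset.sum_congr rfl fun a _ => ?_
  rw [← Finset.sum_mul, ← Int.cast_sum, ← card_sqrt_eq_sum hN]
  simp

theorem sum_range_jacobi_eq_zero {e : ℕ} (hodd : Odd e) (he : Squarefree e) (h1 : e ≠ 1) :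
    ∑ b ∈ Finset.range e, J(b | e) = 0 := by
  have : NeZero e := ⟨he.ne_zero⟩
  rw [← jacobiMulChar_sum_eq_zero hodd he h1, sum_zmod_eq_sum_range]
  simp [jacobiMulChar_natCast]

/-- With `a = b + e i` the symbol depends only on `b`, and the contribution of `e i` vanishes
because the symbols sum to zero over a period. -/
theorem sum_range_mul_jacobi {e t : ℕ} (hodd : Odd e) (he : Squarefree e) (h1 : e ≠ 1) :
    ∑ a ∈ Finset.range (e * t), (a : ℤ) * J(a | e) =
      t * ∑ b ∈ Finset.range e, (b : ℤ) * J(b | e) := by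
  have h : ∀ b i : ℕ, (((b + e * i : ℕ) : ℤ)) * J((b + e * i : ℕ) | e) =
      b * J(b | e) + e * i * J(b | e) := fun b i => by
    rw [jacobiSym.mod_left' (a₁ := ((b + e * i : ℕ) : ℤ)) (a₂ := b) (by simp)]
    push_cast
    ring
  rw [sum_range_mul_eq]
  simp only [h, Finset.sum_add_distrib, Finset.sum_const, Finset.card_range, nsmul_eq_mul,
    ← Finset.mul_sum, ← Finset.sum_mul]
  rw [sum_range_jacobi_eq_zero hodd he h1]
  simp

/-- The character is even, so `b ↦ e - b` sends the sum to `e · 0` minus itself. -/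
theorem sum_range_jacobi_eq_zero_of_mod_four {e : ℕ} (he : Squarefree e) (h4 : e % 4 = 1)
    (h1 : e ≠ 1) : ∑ b ∈ Finset.range e, (b : ℤ) * J(b | e) = 0 := by
  have : NeZero e := ⟨he.ne_zero⟩
  have hodd : Odd e := Nat.odd_iff.2 (by omega)
  have e1 : ∑ b ∈ Finset.range e, (b : ℤ) * J(b | e) =
      ∑ x : ZMod e, (x.val : ℤ) * jacobiMulChar e x := by
    rw [sum_zmod_eq_sum_range]
    refine Finset.sum_congr rfl fun b hb => ?_
    rw [jacobiMulChar_natCast, ZMod.val_cast_of_lt (Finset.mem_range.1 hb)]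
  have e2 : ∀ x : ZMod e, ((-x).val : ℤ) * jacobiMulChar e (-x) =
      e * jacobiMulChar e x - x.val * jacobiMulChar e x := fun x => by
    rw [jacobiMulChar_neg e hodd, ZMod.χ₄_nat_one_mod_four h4, one_mul, ← sub_mul]
    rcases eq_or_ne x 0 with rfl | hx
    · have : jacobiMulChar e 0 = 0 := by
        have : Fact (1 < e) := ⟨by have := NeZero.pos e; omega⟩
        exact MulChar.map_zero _
      simp [this]
    · have : NeZero x := ⟨hx⟩
      rw [ZMod.val_neg_of_ne_zero, Nat.cast_sub x.val_lt.le]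
  have e3 := Equiv.sum_comp (Equiv.neg (ZMod e)) fun x => (x.val : ℤ) * jacobiMulChar e x
  simp only [Equiv.neg_apply, e2, Finset.sum_sub_distrib, ← Finset.mul_sum,
    jacobiMulChar_sum_eq_zero hodd he h1] at e3
  rw [e1]
  linarith

/-- The sum of the residues of `-x²` modulo a squarefree `N`. -/
theorem sum_val_neg_sq {N : ℕ} (hN : Squarefree N) :
    2 * ∑ a ∈ Finset.range N, (-(a : ℤ) ^ 2) % N =
      N * (N - 1) - 2 * ∑ d ∈ N.divisors with d % 4 = 3,
        ((N / d : ℕ) : ℤ) * ∑ b ∈ Finset.range d, (b : ℤ) * J(b | d) := by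
  have : NeZero N := ⟨hN.ne_zero⟩
  have h0 : ∑ a ∈ Finset.range N, (-(a : ℤ) ^ 2) % N = ∑ x : ZMod N, ((-(x ^ 2)).val : ℤ) := by
    rw [sum_zmod_eq_sum_range]
    refine Finset.sum_congr rfl fun a _ => ?_
    rw [← ZMod.val_intCast]
    simp
  have hneg : ∀ a ∈ Finset.range N, a ≠ 0 → ((-(a : ZMod N)).val : ℤ) = N - a := by
    intro a ha ha0
    have hlt := Finset.mem_range.1 ha
    have : NeZero (a : ZMod N) := ⟨fun h => ha0 <| by
      rw [← ZMod.val_cast_of_lt hlt, h, ZMod.val_zero]⟩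
    rw [ZMod.val_neg_of_ne_zero, ZMod.val_cast_of_lt hlt, Nat.cast_sub hlt.le]
  have key : ∀ e ∈ N.divisors,
      (if Odd e then 2 * ∑ a ∈ Finset.range N, J(a | e) * ((-(a : ZMod N)).val : ℤ) else 0) =
        (if e = 1 then (N : ℤ) * (N - 1) else 0) - (if e % 4 = 3 then
          2 * (((N / e : ℕ) : ℤ) * ∑ b ∈ Finset.range e, (b : ℤ) * J(b | e)) else 0) := by
    intro e he
    obtain ⟨t, rfl⟩ := Nat.dvd_of_mem_divisors he
    rcases Nat.even_or_odd e with heven | hodd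
    · rw [if_neg (Nat.not_odd_iff_even.2 heven), if_neg (by rintro rfl; simp at heven), if_neg]
      · simp
      · have := Nat.even_iff.1 heven
        omega
    rw [if_pos hodd]
    rcases eq_or_ne e 1 with rfl | h1
    -- Negation permutes the residues, so the trivial symbol contributes `0 + 1 + ⋯ + (t - 1)`.
    · have h := Equiv.sum_comp (Equiv.neg (ZMod (1 * t))) fun x => (x.val : ℤ)
      rw [sum_zmod_eq_sum_range, sum_zmod_eq_sum_range] at h
      simp only [jacobiSym.one_right, one_mul, if_true, Nat.one_mod, Equiv.neg_apply] at h ⊢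
      rw [h, Finset.sum_congr rfl (g := fun a : ℕ => (a : ℤ))
        fun a ha => by rw [ZMod.val_cast_of_lt (by rw [one_mul]; exact Finset.mem_range.1 ha)]]
      have := Finset.sum_range_id_mul_two t
      have ht : 1 ≤ t := by
        rcases Nat.eq_zero_or_pos t with rfl | h
        · simp at he
        · exact h
      zify [ht] at this
      norm_num
      linarith
    · have hsq : Squarefree e := hN.squarefree_of_dvd (dvd_mul_right _ _)
      have hpos : 0 < e := Nat.pos_of_ne_zero hsq.ne_zero
      -- The residue of `-a` is `N - a` except at `a = 0`, where the symbol vanishes because `e ≠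
      -- 1`.
      have hval : ∀ a ∈ Finset.range (e * t), J(a | e) * ((-(a : ZMod (e * t))).val : ℤ) =
          ((e * t : ℕ) : ℤ) * J(a | e) - a * J(a | e) := by
        intro a ha
        rcases eq_or_ne a 0 with rfl | h0
        · simp [jacobiSym.zero_left (b := e) (by omega)]
        · rw [hneg a ha h0]
          ring
      have hsum : ∑ a ∈ Finset.range (e * t), J(a | e) = 0 := by
        rw [sum_range_mul_eq]
        trans t * ∑ b ∈ Finset.range e, J(b | e)
        swap
        · rw [sum_range_jacobi_eq_zero hodd hsq h1, mul_zero]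
        rw [Finset.mul_sum]
        refine Finset.sum_congr rfl fun b _ => ?_
        rw [Finset.sum_congr rfl (g := fun _ => J(b | e))
          fun i _ => jacobiSym.mod_left' (by simp)]
        simp
      rw [Finset.sum_congr rfl hval, Finset.sum_sub_distrib, ← Finset.mul_sum, hsum,
        sum_range_mul_jacobi hodd hsq h1, if_neg h1, Nat.mul_div_cancel_left _ hpos]
      split_ifs with h3
      · ring
      · have := Nat.odd_iff.1 hodd
        rw [sum_range_jacobi_eq_zero_of_mod_four hsq (by omega) h1]
        ring
  rw [h0, sum_sq_zmod hN (fun x => ((-x).val : ℤ)), Finset.mul_sum, Finset.mul_sum,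
    Finset.sum_filter, Finset.sum_filter]
  simp only [Int.cast_id]
  rw [Finset.sum_congr rfl key, Finset.sum_sub_distrib, Finset.sum_ite_eq' N.divisors 1, if_pos]
  exact Nat.one_mem_divisors.2 hN.ne_zero

end SquareRoots

/-! ### Area and lattice points of the parabolic region -/

section ParabolicRegion

open MeasureTheory

theorem volume_parabolicRegion : (volume parabolicRegion).toReal = 8 / 3 := by
  have hmeas : MeasurableSet parabolicRegion := by
    apply measurableSet_le <;> fun_prop
  have hsec : ∀ x : ℝ,
      volume (Prod.mk x ⁻¹' parabolicRegion) = ENNReal.ofReal (2 * (1 - x ^ 2)) := by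
    intro x
    have : Prod.mk x ⁻¹' parabolicRegion = Set.Icc (-(1 - x ^ 2)) (1 - x ^ 2) := by
      ext y
      simp [parabolicRegion, abs_le]
    rw [this, Real.volume_Icc]
    ring_nf
  -- `ENNReal.ofReal` truncates negative section lengths to `0`, so only `(-1, 1]` contributes.
  have hzero : ∀ x ∉ Set.Ioc (-1 : ℝ) 1, ENNReal.ofReal (2 * (1 - x ^ 2)) = 0 := by
    intro x hx
    apply ENNReal.ofReal_of_nonpos
    by_contra! h
    have : |x| < 1 := by rw [← sq_lt_one_iff_abs_lt_one]; linarith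
    exact hx ⟨(abs_lt.1 this).1, (abs_lt.1 this).2.le⟩
  rw [Measure.volume_eq_prod, Measure.prod_apply hmeas]
  simp only [hsec]
  rw [← setLIntegral_eq_of_support_subset (s := Set.Ioc (-1 : ℝ) 1)
      (fun x hx => by_contra fun h => hx (hzero x h)),
    ← ofReal_integral_eq_lintegral_ofReal, ENNReal.toReal_ofReal,
    ← intervalIntegral.integral_of_le (by norm_num)]
  · rw [intervalIntegral.integral_const_mul, intervalIntegral.integral_sub (by simp) (by simp)]
    simp
    norm_num
  · rw [← intervalIntegral.integral_of_le (by norm_num)]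
    refine intervalIntegral.integral_nonneg (by norm_num) fun x hx => ?_
    nlinarith [hx.1, hx.2]
  · exact (by fun_prop : Continuous fun x : ℝ => 2 * (1 - x ^ 2)).integrableOn_Ioc
  · refine ae_restrict_of_forall_mem measurableSet_Ioc fun x hx => ?_
    simp only [Pi.zero_apply]
    nlinarith [hx.1, hx.2]

theorem latticePointCount_parabolicRegion_eq_card (N : ℕ) (hN : 0 < N) :
    (latticePointCount parabolicRegion N : ℤ) =
      ∑ m ∈ Finset.Icc (-N : ℤ) N, (2 * (((N : ℤ) ^ 2 - m ^ 2) / N) + 1) := by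
  have hset : {n : ℤ × ℤ | (N : ℝ)⁻¹ • ((n.1 : ℝ), (n.2 : ℝ)) ∈ parabolicRegion} =
      (((Finset.Icc (-N : ℤ) N).sigma fun m =>
        Finset.Icc (-(((N : ℤ) ^ 2 - m ^ 2) / N)) (((N : ℤ) ^ 2 - m ^ 2) / N)).map
        (Equiv.sigmaEquivProd ℤ ℤ).toEmbedding : Set (ℤ × ℤ)) := by
    ext ⟨m, n⟩
    have hN' : (0 : ℝ) < N := by exact_mod_cast hN
    have h1 : ((N : ℝ)⁻¹ • ((m : ℝ), (n : ℝ)) ∈ parabolicRegion) ↔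
        (N : ℤ) * |n| ≤ (N : ℤ) ^ 2 - m ^ 2 := by
      simp only [parabolicRegion, Prod.smul_mk, smul_eq_mul, Set.mem_ofPred_eq, abs_mul, abs_inv,
        Nat.abs_cast]
      rw [← mul_le_mul_iff_right₀ (pow_pos hN' 2)]
      have e1 : (N : ℝ) ^ 2 * ((N : ℝ)⁻¹ * |(n : ℝ)|) = ((N * |n| : ℤ) : ℝ) := by
        push_cast
        field_simp
      have e2 : (N : ℝ) ^ 2 * (1 - ((N : ℝ)⁻¹ * m) ^ 2) = (((N : ℤ) ^ 2 - m ^ 2 : ℤ) : ℝ) := by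
        push_cast
        field_simp
      rw [e1, e2, Int.cast_le]
    rw [Set.mem_ofPred_eq, h1]
    have hN0 : (0 : ℤ) < N := by exact_mod_cast hN
    have h2 : (N : ℤ) * |n| ≤ (N : ℤ) ^ 2 - m ^ 2 ↔ |n| ≤ ((N : ℤ) ^ 2 - m ^ 2) / N := by
      rw [Int.le_ediv_iff_mul_le hN0, mul_comm]
    have h3 : |n| ≤ ((N : ℤ) ^ 2 - m ^ 2) / N → |m| ≤ N := by
      intro h
      have : 0 ≤ (N : ℤ) ^ 2 - m ^ 2 := (mul_nonneg hN0.le (abs_nonneg n)).trans (h2.2 h)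
      exact abs_le_of_sq_le_sq (by linarith) hN0.le
    rw [h2]
    simp
    rw [← abs_le, ← abs_le]
    tauto
  rw [latticePointCount, hset, Set.ncard_coe_finset, Finset.card_map, Finset.card_sigma]
  push_cast
  refine Finset.sum_congr rfl fun m hm => ?_
  have : 0 ≤ ((N : ℤ) ^ 2 - m ^ 2) / N := by
    have := Finset.mem_Icc.1 hm
    exact Int.ediv_nonneg (by nlinarith) (by positivity)
  rw [Int.card_Icc]
  omega

theorem mul_latticePointCount_parabolicRegion (N : ℕ) (hN : 0 < N) :
    3 * (N * (latticePointCount parabolicRegion N : ℤ)) =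
      N * (8 * N ^ 2 + 6 * N + 1) - 12 * ∑ a ∈ Finset.range N, (-(a : ℤ) ^ 2) % N := by
  -- The floor becomes a remainder, and `N²` drops out of it modulo `N`.
  have hg : ∀ m : ℤ, (N : ℤ) * (2 * (((N : ℤ) ^ 2 - m ^ 2) / N) + 1) =
      2 * N ^ 2 + N - 2 * m ^ 2 - 2 * ((-m ^ 2) % N) := by
    intro m
    have h1 := Int.mul_ediv_add_emod ((N : ℤ) ^ 2 - m ^ 2) N
    have h2 : ((N : ℤ) ^ 2 - m ^ 2) % N = (-m ^ 2) % N := by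
      rw [show (N : ℤ) ^ 2 - m ^ 2 = -m ^ 2 + N * N by ring]
      exact Int.add_mul_emod_self_left _ _ _
    linarith
  have hsq : ∀ n : ℕ, 6 * ∑ a ∈ Finset.range n, (a : ℤ) ^ 2 = (n - 1) * n * (2 * n - 1) := by
    intro n
    induction n with
    | zero => simp
    | succ n ih =>
      rw [Finset.sum_range_succ, mul_add, ih]
      push_cast
      ring
  rw [latticePointCount_parabolicRegion_eq_card N hN, Finset.mul_sum]
  simp only [hg]
  set g : ℤ → ℤ := fun m => 2 * N ^ 2 + N - 2 * m ^ 2 - 2 * ((-m ^ 2) % N) with hgdef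
  have heven : ∀ m, g (-m) = g m := fun m => by simp [hgdef]
  -- Folding by evenness counts `m = 0` twice; the endpoints `±n` lie outside `range n`.
  have hs : ∀ n : ℕ, ∑ m ∈ Finset.Icc (-n : ℤ) n, g m =
      2 * ∑ a ∈ Finset.range n, g a + 2 * g n - g 0 := by
    intro n
    rw [Finset.sum_Icc_of_even_eq_range heven, Finset.sum_range_succ, two_nsmul]
    ring
  rw [hs]
  have h0 : g 0 = 2 * N ^ 2 + N := by simp [hgdef]
  have hNN : g N = N := by
    have : (-(N : ℤ) ^ 2) % N = 0 := Int.emod_eq_zero_of_dvd (Dvd.intro (-(N : ℤ)) (by ring))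
    simp only [hgdef, this]
    ring
  have hsum : ∑ a ∈ Finset.range N, g a = N * (2 * N ^ 2 + N) -
      2 * ∑ a ∈ Finset.range N, (a : ℤ) ^ 2 - 2 * ∑ a ∈ Finset.range N, (-(a : ℤ) ^ 2) % N := by
    simp only [hgdef, Finset.sum_sub_distrib, ← Finset.mul_sum, Finset.sum_const,
      Finset.card_range, nsmul_eq_mul]
  rw [hsum, h0, hNN]
  linear_combination (-2) * hsq N

/-- This isolates the elementary half: Dirichlet's class number formula enters only as the
hypothesis `H`. -/
theorem latticePointCount_sub_volume_of_classNumberFormula (N : ℕ) (hN : Squarefree N)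
    (H : ∀ d : ℕ, Squarefree d → d % 4 = 3 →
      ((∑ b ∈ Finset.range d, (b : ℤ) * J(b | d) : ℤ) : ℝ) =
        -(d * (classWeight d * classNumberNeg d))) :
    (latticePointCount parabolicRegion (N : ℝ) : ℝ)
        - (volume parabolicRegion).toReal * (N : ℝ) ^ 2
      = 7 / 3 - 4 * ∑ d ∈ N.divisors.filter (fun d => d % 4 = 3),
          classWeight d * (classNumberNeg d : ℝ) := by
  have hpos := Nat.pos_of_ne_zero hN.ne_zero
  have hN0 : (N : ℝ) ≠ 0 := by exact_mod_cast hN.ne_zero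
  have h1 := mul_latticePointCount_parabolicRegion N hpos
  have h2 := sum_val_neg_sq hN
  have h3 : ((∑ d ∈ N.divisors with d % 4 = 3,
      ((N / d : ℕ) : ℤ) * ∑ b ∈ Finset.range d, (b : ℤ) * J(b | d) : ℤ) : ℝ) =
      -(N * ∑ d ∈ N.divisors.filter (fun d => d % 4 = 3),
          classWeight d * (classNumberNeg d : ℝ)) := by
    rw [Int.cast_sum, Finset.mul_sum, ← Finset.sum_neg_distrib]
    refine Finset.sum_congr rfl fun d hd => ?_
    obtain ⟨hd1, hd2⟩ := Finset.mem_filter.1 hd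
    obtain ⟨t, rfl⟩ := Nat.dvd_of_mem_divisors hd1
    have hsq : Squarefree d := hN.squarefree_of_dvd (dvd_mul_right _ _)
    rw [Nat.mul_div_cancel_left _ (Nat.pos_of_ne_zero hsq.ne_zero), Int.cast_mul, H d hsq hd2]
    push_cast
    ring
  rw [volume_parabolicRegion]
  have h1' := congrArg (Int.cast : ℤ → ℝ) h1
  have h2' := congrArg (Int.cast : ℤ → ℝ) h2
  rw [Int.cast_sub, Int.cast_mul _ (∑ d ∈ N.divisors with d % 4 = 3, _), h3] at h2'
  push_cast at h1' h2'
  apply mul_left_cancel₀ hN0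
  linear_combination (1 / 3) * h1' - 2 * h2'

end ParabolicRegion

/-! ### Quadratic Gauss sums via theta asymptotics -/

section QuadraticGaussSum

open Complex Filter Topology

theorem summable_exp_neg_pi_sq : Summable fun n : ℤ => Real.exp (-Real.pi * (n : ℝ) ^ 2) := by
  simpa using summable_pow_mul_jacobiTheta₂_term_bound 0 one_pos 0

theorem norm_cexp_gaussian (v : ℂ) (n : ℤ) (x : ℝ) :
    ‖cexp (-Real.pi * v * n ^ 2 + 2 * Real.pi * (-I * x) * n)‖ =
      Real.exp (-Real.pi * (v.re * (n : ℝ) ^ 2)) := by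
  rw [norm_exp]
  congr 1
  have : (-Real.pi * v * n ^ 2 + 2 * Real.pi * (-I * x) * n : ℂ) =
      ((-Real.pi * (n : ℝ) ^ 2 : ℝ) : ℂ) * v + ((-2 * Real.pi * x * n : ℝ) : ℂ) * I := by
    push_cast
    ring
  rw [this, add_re, re_ofReal_mul, re_ofReal_mul, I_re]
  ring

/-- A shifted Gaussian sum of large complex width is asymptotic to the corresponding integral. -/
theorem tendsto_gaussian_sum {ι : Type*} {l : Filter ι} [l.IsCountablyGenerated] {v : ι → ℂ}
    (hv : Tendsto (fun i => (v i).re) l atTop) (x : ℝ) :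
    Tendsto (fun i => 1 / (v i) ^ (1 / 2 : ℂ) *
      ∑' n : ℤ, cexp (-Real.pi / v i * (n + x) ^ 2)) l (𝓝 1) := by
  have h1 : ∀ᶠ i in l, 1 ≤ (v i).re := hv.eventually_ge_atTop 1
  -- This is the Poisson dual of the sum; as the real part of `v` grows, only its term `n = 0`
  -- survives.
  have h2 : Tendsto (fun i => ∑' n : ℤ,
      cexp (-Real.pi * v i * n ^ 2 + 2 * Real.pi * (-I * x) * n)) l
      (𝓝 (∑' n : ℤ, if n = 0 then 1 else 0)) := by
    refine tendsto_tsum_of_dominated_convergence summable_exp_neg_pi_sq (fun n => ?_) ?_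
    · split_ifs with hn
      · simpa [hn] using tendsto_const_nhds
      · rw [tendsto_zero_iff_norm_tendsto_zero]
        simp only [norm_cexp_gaussian]
        refine Real.tendsto_exp_atBot.comp ?_
        have hn2 : 0 < (n : ℝ) ^ 2 := by positivity
        exact (hv.atTop_mul_const hn2).const_mul_atTop_of_neg (by linarith [Real.pi_pos])
    · filter_upwards [h1] with i hi n
      rw [norm_cexp_gaussian]
      refine Real.exp_le_exp.2 ?_
      rw [neg_mul, neg_mul, neg_le_neg_iff]
      refine mul_le_mul_of_nonneg_left ?_ Real.pi_pos.le
      nlinarith [sq_nonneg (n : ℝ)]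
  rw [tsum_ite_eq] at h2
  refine h2.congr' ?_
  filter_upwards [h1] with i hi
  rw [Complex.tsum_exp_neg_quadratic (by linarith)]
  congr 2
  ext n
  congr 3
  linear_combination (-x : ℂ) * I_sq

theorem summable_gaussian_shift {v : ℂ} (hv : 0 < (1 / v).re) (x : ℝ) :
    Summable fun n : ℤ => cexp (-Real.pi / v * (n + x) ^ 2) := by
  refine (summable_pow_mul_jacobiTheta₂_term_bound ((1 / v).re * |x|) hv 0).of_norm_bounded
    fun n => ?_
  have h : (-Real.pi / v * (n + x) ^ 2 : ℂ) = ((-Real.pi * (n + x) ^ 2 : ℝ) : ℂ) * (1 / v) := by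
    push_cast
    ring
  rw [norm_exp, h, re_ofReal_mul, pow_zero, one_mul, mul_assoc]
  refine Real.exp_le_exp.2 ?_
  rw [neg_mul, neg_mul, neg_le_neg_iff]
  refine mul_le_mul_of_nonneg_left ?_ Real.pi_pos.le
  have : -(|x| * |(n : ℝ)|) ≤ n * x := by
    rw [← abs_mul, mul_comm (n : ℝ)]
    exact neg_abs_le _
  have h2 : (n : ℝ) ^ 2 - 2 * (|x| * |(n : ℝ)|) ≤ (n + x) ^ 2 := by nlinarith [sq_nonneg x]
  push_cast
  nlinarith [mul_le_mul_of_nonneg_right h2 hv.le]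

/-- A Gaussian sum weighted by a periodic function is asymptotic to a multiple of the mean of
the function. -/
theorem tendsto_periodic_gaussian_sum {ι : Type*} {l : Filter ι} [l.IsCountablyGenerated]
    {v : ι → ℂ} (hv : Tendsto (fun i => (v i).re) l atTop) {T : ℕ} (hT : 0 < T) {f : ℤ → ℂ}
    (hf : ∀ n q : ℤ, f (n + T * q) = f n) :
    Tendsto (fun i => 1 / (v i) ^ (1 / 2 : ℂ) *
      ∑' n : ℤ, f n * cexp (-Real.pi / (T ^ 2 * v i) * n ^ 2)) l
      (𝓝 (∑ r ∈ Finset.range T, f r)) := by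
  have : NeZero T := ⟨hT.ne'⟩
  have hT0 : (T : ℂ) ≠ 0 := by exact_mod_cast hT.ne'
  -- Writing `n = qT + r` leaves, for each residue `r`, a Gaussian sum shifted by `r/T`.
  have h1 : Tendsto (fun i => ∑ r : Fin T, f r * (1 / (v i) ^ (1 / 2 : ℂ) *
      ∑' n : ℤ, cexp (-Real.pi / v i * (n + (r / T : ℝ)) ^ 2))) l
      (𝓝 (∑ r : Fin T, f r * 1)) :=
    tendsto_finsetSum _ fun r _ => (tendsto_gaussian_sum hv _).const_mul _
  have h2 : ∑ r : Fin T, f r * 1 = ∑ r ∈ Finset.range T, f r := by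
    simp [Finset.sum_range]
  rw [h2] at h1
  refine h1.congr' ?_
  filter_upwards [hv.eventually_gt_atTop 0] with i hi
  have hv0 : v i ≠ 0 := fun h => by simp [h] at hi
  have hterm : ∀ (n : ℤ) (r : Fin T), f (n * T + (r : ℕ)) *
      cexp (-Real.pi / (T ^ 2 * v i) * ((n * T + (r : ℕ) : ℤ) : ℂ) ^ 2) =
      f r * cexp (-Real.pi / v i * (n + (r / T : ℝ)) ^ 2) := by
    intro n r
    have := hf r n
    rw [show n * T + ((r : ℕ) : ℤ) = r + T * n by ring, this]
    congr 2
    push_cast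
    field_simp
    ring
  have hre : 0 < (1 / v i).re := by
    rw [one_div, inv_re]
    exact div_pos hi (normSq_pos.2 hv0)
  have hs : ∀ r : Fin T,
      Summable fun n : ℤ => f r * cexp (-Real.pi / v i * (n + (r / T : ℝ)) ^ 2) :=
    fun r => (summable_gaussian_shift hre _).mul_left _
  have hsp : Summable fun p : ℤ × Fin T =>
      f p.2 * cexp (-Real.pi / v i * (p.1 + (p.2 / T : ℝ)) ^ 2) := by
    refine Summable.of_norm ((summable_prod_of_nonneg fun _ => norm_nonneg _).2 ⟨fun n => ?_, ?_⟩)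
    · exact Summable.of_finite
    · simp only [tsum_fintype]
      exact summable_sum fun r _ => (hs r).norm
  rw [← (Int.divModEquiv T).symm.tsum_eq]
  simp only [Int.divModEquiv_symm_apply]
  rw [tsum_congr fun p : ℤ × Fin T => hterm p.1 p.2, hsp.tsum_prod]
  simp only [tsum_fintype]
  rw [Summable.tsum_finsetSum fun r _ => hs r, Finset.mul_sum]
  refine Finset.sum_congr rfl fun r _ => ?_
  rw [tsum_mul_left]
  ring

theorem ofReal_mul_cpow {r : ℝ} (hr : 0 < r) {z : ℂ} (hz : z ≠ 0) (c : ℂ) :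
    ((r : ℂ) * z) ^ c = (r : ℂ) ^ c * z ^ c := by
  have hr0 : (r : ℂ) ≠ 0 := by exact_mod_cast hr.ne'
  rw [cpow_def_of_ne_zero (mul_ne_zero hr0 hz), cpow_def_of_ne_zero hr0, cpow_def_of_ne_zero hz,
    ← exp_add, log_ofReal_mul hr hz, ofReal_log hr.le]
  ring_nf

theorem one_div_sub_eq_add {d t : ℂ} (hd : d ≠ 0) (ht : t ≠ 0) (hz : 1 + I / (2 * d * t) ≠ 0) :
    1 / (1 / (d ^ 2 * t) - 2 * I / d) =
      I * d / 2 + 1 / (2 ^ 2 * (t * (1 + I / (2 * d * t)))) := by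
  have e1 : 1 / (d ^ 2 * t) - 2 * I / d = -2 * I / d * (1 + I / (2 * d * t)) := by
    field_simp
    linear_combination I_sq
  have hI : I ≠ 0 := I_ne_zero
  rw [e1]
  have e2 : d * t * 4 * (1 + I / (2 * d * t)) = d * t * 4 + 2 * I := by
    field_simp
    ring
  generalize 1 + I / (2 * d * t) = w at *
  field_simp
  linear_combination (1 / 2) * e2 - (2 * d * t * w) * I_sq

/-- Landsberg–Schaar reciprocity for the quadratic Gauss sum of odd modulus. -/
theorem sum_exp_sq_eq {d : ℕ} (hd : 0 < d) :
    ∑ r ∈ Finset.range d, cexp (2 * Real.pi * I * r ^ 2 / d) =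
      (1 + cexp (-Real.pi * I * d / 2)) / (-2 * I / d) ^ (1 / 2 : ℂ) := by
  have hd0 : (d : ℂ) ≠ 0 := by exact_mod_cast hd.ne'
  set a : ℝ → ℂ := fun t => 1 / (d ^ 2 * t) - 2 * I / d with ha
  set f : ℤ → ℂ := fun n => cexp (2 * Real.pi * I * n ^ 2 / d) with hf
  set g : ℤ → ℂ := fun n => cexp (-Real.pi * I * d * n ^ 2 / 2) with hg
  have hfper : ∀ n q : ℤ, f (n + d * q) = f n := by
    intro n q
    refine exp_eq_exp_iff_exists_int.2 ⟨2 * n * q + d * q ^ 2, ?_⟩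
    push_cast
    field_simp
    ring
  have hgper : ∀ n q : ℤ, g (n + (2 : ℕ) * q) = g n := by
    intro n q
    refine exp_eq_exp_iff_exists_int.2 ⟨-d * (n * q + q ^ 2), ?_⟩
    push_cast
    ring
  -- The same theta series is read in two ways as `t → ∞`: directly, with the weight `f` of period
  -- `d`, and after Poisson summation, with the weight `g` of period `2`. Equating the limits gives
  -- the reciprocity.
  have h1 := tendsto_periodic_gaussian_sum (l := (atTop : Filter ℝ)) (v := fun t => (t : ℂ))
    tendsto_id hd hfper
  have h2 := tendsto_periodic_gaussian_sum (l := (atTop : Filter ℝ))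
    (v := fun t => (t : ℂ) * (1 + I / (2 * d * t))) (by
      refine tendsto_id.congr' ?_
      filter_upwards [eventually_gt_atTop 0] with t ht
      have ht0 : (t : ℂ) ≠ 0 := by exact_mod_cast ht.ne'
      have : (t : ℂ) * (1 + I / (2 * d * t)) = t + ((1 / (2 * d) : ℝ) : ℂ) * I := by
        push_cast
        field_simp
      rw [this, add_re, re_ofReal_mul, I_re, ofReal_re]
      simp) two_pos hgper
  have hinv : Tendsto (fun t : ℝ => (t : ℂ)⁻¹) atTop (𝓝 0) := by
    simpa [Function.comp_def] using (continuous_ofReal.tendsto 0).comp tendsto_inv_atTop_zero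
  have hlim_a : Tendsto a atTop (𝓝 (-2 * I / d)) := by
    have : Tendsto (fun t : ℝ => 1 / (d : ℂ) ^ 2 * (t : ℂ)⁻¹ - 2 * I / d) atTop
        (𝓝 (1 / (d : ℂ) ^ 2 * 0 - 2 * I / d)) := (hinv.const_mul _).sub_const _
    convert! this using 2
    · simp only [ha]
      field_simp
    · ring
  have hlim_z : Tendsto (fun t : ℝ => 1 + I / (2 * d * t)) atTop (𝓝 1) := by
    have : Tendsto (fun t : ℝ => 1 + I / (2 * d) * (t : ℂ)⁻¹) atTop
        (𝓝 (1 + I / (2 * d) * 0)) := (hinv.const_mul _).const_add _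
    convert! this using 2
    · rw [div_mul_eq_div_div, div_eq_mul_inv]
    · ring
  have hs : (-2 * I / d : ℂ) ∈ slitPlane := by
    right
    have : (-2 * I / d : ℂ) = ((-2 / d : ℝ) : ℂ) * I := by
      push_cast
      ring
    rw [this, im_ofReal_mul]
    have : (-2 / d : ℝ) ≠ 0 := by positivity
    simpa using this
  have hs0 : (-2 * I / d : ℂ) ≠ 0 := slitPlane_ne_zero hs
  have h3 : Tendsto (fun t : ℝ => (1 / (t : ℂ) ^ (1 / 2 : ℂ) *
      ∑' n : ℤ, f n * cexp (-Real.pi / (d ^ 2 * t) * n ^ 2)) * (a t) ^ (1 / 2 : ℂ) /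
        (1 + I / (2 * d * t)) ^ (1 / 2 : ℂ)) atTop
      (𝓝 ((∑ r ∈ Finset.range d, f r) * (-2 * I / d) ^ (1 / 2 : ℂ) / 1 ^ (1 / 2 : ℂ))) :=
    (h1.mul (hlim_a.cpow tendsto_const_nhds hs)).div
      (hlim_z.cpow tendsto_const_nhds one_mem_slitPlane) (by simp)
  have h4 : ∑ r ∈ Finset.range 2, g r =
      (∑ r ∈ Finset.range d, f r) * (-2 * I / d) ^ (1 / 2 : ℂ) / 1 ^ (1 / 2 : ℂ) := by
    refine tendsto_nhds_unique (h2.congr' ?_) h3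
    filter_upwards [eventually_gt_atTop 0] with t ht
    have ht0 : (t : ℂ) ≠ 0 := by exact_mod_cast ht.ne'
    have hare : (a t).re = 1 / (d ^ 2 * t) := by
      have : a t = ((1 / (d ^ 2 * t) : ℝ) : ℂ) + ((-2 / d : ℝ) : ℂ) * I := by
        simp only [ha]
        push_cast
        ring
      rw [this, add_re, re_ofReal_mul, I_re, ofReal_re]
      ring
    have hapos : 0 < (a t).re := by
      rw [hare]
      positivity
    have ha0 : a t ≠ 0 := fun h => by simp [h] at hapos
    have hz0 : (1 + I / (2 * d * t) : ℂ) ≠ 0 := by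
      intro h
      have : (1 + I / (2 * d * t) : ℂ) = 1 + ((1 / (2 * d * t) : ℝ) : ℂ) * I := by
        push_cast
        ring
      rw [this] at h
      have := congrArg re h
      rw [add_re, re_ofReal_mul, I_re] at this
      simp at this
    have e1 : ∑' n : ℤ, f n * cexp (-Real.pi / (d ^ 2 * t) * n ^ 2) =
        1 / (a t) ^ (1 / 2 : ℂ) * ∑' n : ℤ, cexp (-Real.pi / a t * n ^ 2) := by
      have := Complex.tsum_exp_neg_quadratic hapos 0
      simp only [mul_zero, zero_mul, add_zero] at this
      rw [← this]
      refine tsum_congr fun n => ?_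
      rw [hf, ← exp_add]
      congr 1
      simp only [ha]
      field_simp
      ring
    -- The dual Gaussian has exponent `1 / a t`; its limiting part `i d / 2` is the periodic weight
    -- `g`, and the rest is a Gaussian of width `t (1 + i/(2dt))`.
    have e2 : ∀ n : ℤ, cexp (-Real.pi / a t * n ^ 2) =
        g n * cexp (-Real.pi / ((2 : ℕ) ^ 2 * (t * (1 + I / (2 * d * t)))) * n ^ 2) := by
      intro n
      rw [hg, ← exp_add]
      congr 1
      have key : 1 / a t = I * d / 2 + 1 / ((2 : ℕ) ^ 2 * (t * (1 + I / (2 * d * t)))) := by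
        push_cast
        exact one_div_sub_eq_add hd0 ht0 hz0
      linear_combination (-Real.pi * n ^ 2 : ℂ) * key
    rw [e1, tsum_congr e2, ofReal_mul_cpow ht hz0]
    have : (a t) ^ (1 / 2 : ℂ) ≠ 0 := by simp [cpow_eq_zero_iff, ha0]
    field_simp
  have h5 : ((-2 * I / d : ℂ)) ^ (1 / 2 : ℂ) ≠ 0 := by
    rw [Ne, cpow_eq_zero_iff]
    exact fun h => hs0 h.1
  rw [eq_div_iff h5]
  simp only [Finset.sum_range_succ, Finset.sum_range_zero, one_cpow, div_one, hf, hg] at h4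
  push_cast at h4
  rw [← h4]
  simp

theorem sum_exp_sq_eq_of_mod_four {d : ℕ} (hd : d % 4 = 3) :
    ∑ r ∈ Finset.range d, cexp (2 * Real.pi * I * r ^ 2 / d) = I * Real.sqrt d := by
  have hpos : (0 : ℝ) < d := by exact_mod_cast (by omega : 0 < d)
  have hsq : ((Real.sqrt d : ℝ) : ℂ) ^ 2 = d := by
    rw [← ofReal_pow, Real.sq_sqrt hpos.le, ofReal_natCast]
  have hs0 : ((Real.sqrt d : ℝ) : ℂ) ≠ 0 := by exact_mod_cast (Real.sqrt_pos.2 hpos).ne'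
  -- Of the two square roots of `-2i/d`, the principal one has positive real part. This choice fixes
  -- the sign of the Gauss sum.
  have h1 : (-2 * I / d : ℂ) ^ (1 / 2 : ℂ) = (1 - I) / Real.sqrt d := by
    have : (-2 * I / d : ℂ) = ((1 - I) / Real.sqrt d) ^ 2 := by
      rw [div_pow, hsq]
      congr 1
      linear_combination (-1 : ℂ) * I_sq
    rw [this, one_div, sq_cpow_two_inv]
    rw [div_ofReal_re]
    simp [hpos]
  have h2 : cexp (-Real.pi * I * d / 2) = I := by
    obtain ⟨k, hk⟩ : ∃ k : ℕ, d = 4 * k + 3 := ⟨d / 4, by omega⟩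
    have : (-Real.pi * I * d / 2 : ℂ) =
        Real.pi / 2 * I + ((-(k + 1) : ℤ) : ℂ) * (2 * Real.pi * I) := by
      rw [hk]
      push_cast
      ring
    rw [this, exp_add, exp_int_mul_two_pi_mul_I, mul_one, exp_pi_div_two_mul_I]
  have h3 : (1 - I : ℂ) ≠ 0 := by
    intro h
    have := congrArg re h
    simp at this
  rw [sum_exp_sq_eq (by omega), h1, h2]
  field_simp
  linear_combination I_sq

/-- The Jacobi symbol modulo `d` as a complex Dirichlet character. -/
noncomputable def jacobiChar (d : ℕ) [NeZero d] : DirichletCharacter ℂ d :=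
  (jacobiMulChar d).ringHomComp (Int.castRingHom ℂ)

theorem jacobiChar_apply (d : ℕ) [NeZero d] (x : ZMod d) :
    jacobiChar d x = (jacobiMulChar d x : ℂ) := rfl

theorem jacobiChar_natCast (d : ℕ) [NeZero d] (a : ℕ) : jacobiChar d a = (J(a | d) : ℂ) := by
  rw [jacobiChar_apply, jacobiMulChar_natCast]

theorem jacobiChar_ne_one {d : ℕ} [NeZero d] (hodd : Odd d) (hd : Squarefree d) (h1 : d ≠ 1) :
    jacobiChar d ≠ 1 := by
  intro h
  refine jacobiMulChar_ne_one hodd hd h1 (MulChar.ext fun a => ?_)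
  have := congrArg (fun χ : DirichletCharacter ℂ d => χ a) h
  simp only [jacobiChar_apply, MulChar.one_apply_coe] at this ⊢
  exact_mod_cast this

theorem jacobiChar_neg {d : ℕ} [NeZero d] (hd : d % 4 = 3) (x : ZMod d) :
    jacobiChar d (-x) = - jacobiChar d x := by
  rw [jacobiChar_apply, jacobiChar_apply, jacobiMulChar_neg d (Nat.odd_iff.2 (by omega)),
    ZMod.χ₄_nat_three_mod_four hd]
  simp

/-- Counting square roots expands `∑ e(x²/d)` over the divisors `e` of `d`. For `e ≠ d` the sum over
a class modulo `e` is a complete geometric sum of nontrivial roots of unity, so only `e = d`, the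
Gauss sum, survives. -/
theorem sum_jacobi_mul_stdAddChar {d : ℕ} [NeZero d] (hd : Squarefree d) (h4 : d % 4 = 3) :
    gaussSum (jacobiChar d) ZMod.stdAddChar = I * Real.sqrt d := by
  rw [← sum_exp_sq_eq_of_mod_four h4]
  have h1 : ∑ r ∈ Finset.range d, cexp (2 * Real.pi * I * r ^ 2 / d) =
      ∑ x : ZMod d, (ZMod.stdAddChar (x ^ 2) : ℂ) := by
    rw [sum_zmod_eq_sum_range]
    refine Finset.sum_congr rfl fun r _ => ?_
    have := ZMod.stdAddChar_coe (N := d) ((r : ℤ) ^ 2)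
    push_cast at this
    exact this.symm
  rw [h1, sum_sq_zmod hd fun x => (ZMod.stdAddChar x : ℂ), Finset.sum_eq_single d, gaussSum,
    sum_zmod_eq_sum_range]
  · simp only [jacobiChar_natCast]
  · intro e he hed
    obtain ⟨t, rfl⟩ := Nat.dvd_of_mem_divisors (Finset.mem_filter.1 he).1
    have ht : t ≠ 1 := fun h => hed (by simp [h])
    have he0 : 0 < e := Nat.pos_of_ne_zero fun h => by simp [h] at h4
    rw [sum_range_mul_eq]
    refine Finset.sum_eq_zero fun b _ => ?_
    have hterm : ∀ i ∈ Finset.range t, (J((b + e * i : ℕ) | e) : ℂ) *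
        (ZMod.stdAddChar ((b + e * i : ℕ) : ZMod (e * t)) : ℂ) =
        J(b | e) * (ZMod.stdAddChar (b : ZMod (e * t)) : ℂ) *
          (ZMod.stdAddChar (e : ZMod (e * t)) : ℂ) ^ i := by
      intro i _
      rw [jacobiSym.mod_left' (a₁ := ((b + e * i : ℕ) : ℤ)) (a₂ := b) (by simp), Nat.cast_add,
        AddChar.map_add_eq_mul, ← AddChar.map_nsmul_eq_pow, nsmul_eq_mul, Nat.cast_mul,
        mul_comm (e : ZMod (e * t))]
      ring
    rw [Finset.sum_congr rfl hterm, ← Finset.mul_sum, geom_sum_eq, ← AddChar.map_nsmul_eq_pow,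
      nsmul_eq_mul, ← Nat.cast_mul, mul_comm t, ZMod.natCast_self, AddChar.map_zero_eq_one]
    · simp
    · intro h
      rw [← AddChar.map_zero_eq_one (ZMod.stdAddChar (N := e * t))] at h
      have := ZMod.injective_stdAddChar h
      rw [ZMod.natCast_eq_zero_iff] at this
      have h2 : e * t ∣ e * 1 := by rwa [mul_one]
      exact ht (Nat.dvd_one.1 (Nat.dvd_of_mul_dvd_mul_left he0 h2))
  · intro h
    exact absurd (Finset.mem_filter.2 ⟨Nat.mem_divisors_self _ hd.ne_zero,
      Nat.odd_iff.2 (by omega)⟩) h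

theorem sum_jacobi_mul_stdAddChar_mul {d : ℕ} [NeZero d] (hd : Squarefree d) (h4 : d % 4 = 3)
    (k : ZMod d) :
    ∑ x : ZMod d, jacobiChar d x * (ZMod.stdAddChar (k * x) : ℂ) =
      jacobiChar d k * (I * Real.sqrt d) := by
  by_cases hk : IsUnit k
  · obtain ⟨u, rfl⟩ := hk
    have h := gaussSum_mulShift (jacobiChar d) ZMod.stdAddChar u
    rw [sum_jacobi_mul_stdAddChar hd h4] at h
    have hsq : jacobiChar d u * jacobiChar d u = 1 := by
      have h0 : jacobiMulChar d u ≠ 0 := by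
        intro h0
        have := u.isUnit.map (jacobiMulChar d)
        rw [h0] at this
        exact not_isUnit_zero this
      have h2 : jacobiMulChar d u * jacobiMulChar d u = 1 := by
        rcases jacobiSym.trichotomy ((u : ZMod d).cast : ℤ) d with h | h | h
        · exact absurd h h0
        · exact (congrArg (fun z : ℤ => z * z) h : _ = (1 : ℤ) * 1).trans (by norm_num)
        · exact (congrArg (fun z : ℤ => z * z) h : _ = (-1 : ℤ) * -1).trans (by norm_num)
      rw [jacobiChar_apply]
      exact_mod_cast h2
    rw [← h, ← mul_assoc, hsq, one_mul]
    rfl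
  · rw [MulChar.map_nonunit _ hk, zero_mul]
    have hcop : ¬ Nat.Coprime k.val d := by
      rwa [← ZMod.isUnit_iff_coprime, ZMod.natCast_zmod_val]
    obtain ⟨p, hp, ⟨j, hj⟩, m, rfl⟩ := Nat.Prime.not_coprime_iff_dvd.1 hcop
    have hm : m ≠ 0 := fun h => by simp [h] at h4
    have h2 : p ≠ 2 := by
      rintro rfl
      omega
    -- If `p` divides both `k` and the modulus, this `u` fixes `k` and has `χ(u) = -1`; substituting
    -- `u x` for `x` shows that the sum equals its own negative.
    obtain ⟨u, hu, hu1⟩ := exists_jacobiSym_eq_neg_one hp h2 hm (Nat.coprime_of_squarefree_mul hd)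
    have hχ : jacobiChar (p * m) u = -1 := by
      rw [jacobiChar_natCast, hu]
      simp
    have hunit : IsUnit (u : ZMod (p * m)) := by
      by_contra h
      rw [MulChar.map_nonunit _ h] at hχ
      norm_num at hχ
    obtain ⟨v, hv⟩ := hunit
    have hku : k * u = k := by
      rw [← ZMod.natCast_zmod_val k, ← Nat.cast_mul, ZMod.natCast_eq_natCast_iff, hj]
      have := (hu1.mul_left j).mul_left' p
      rwa [mul_one, ← mul_assoc] at this
    have h := Equiv.sum_comp (Units.mulLeft v)
      fun x => jacobiChar (p * m) x * (ZMod.stdAddChar (k * x) : ℂ)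
    simp only [Units.mulLeft_apply, map_mul, hv, hχ, ← mul_assoc, hku] at h
    simp only [neg_mul, one_mul, Finset.sum_neg_distrib] at h
    exact self_eq_neg.1 h.symm

end QuadraticGaussSum

/-! ### The value of the L-function at 1 as a finite sum -/

section LValue

open Complex Filter Topology HurwitzZeta

/-- Bernoulli's inequality applied to `(x/y) ^ s`. The extra factor `1/m` makes the paired Hurwitz
series summable, uniformly for `s` near `1`. -/
theorem abs_rpow_inv_sub_le {x y m s : ℝ} (hm : 0 < m) (hx : m ≤ x) (hy : m ≤ y) (hs : 1 ≤ s)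
    (hxy : |x - y| ≤ 1) : |1 / x ^ s - 1 / y ^ s| ≤ s * (1 / m ^ s * (1 / m)) := by
  wlog hle : x ≤ y generalizing x y
  · rw [abs_sub_comm]
    exact this hy hx (by rwa [abs_sub_comm]) (le_of_not_ge hle)
  have hx0 : 0 < x := hm.trans_le hx
  have hy0 : 0 < y := hm.trans_le hy
  have h1 : 1 + s * (x / y - 1) ≤ (x / y) ^ s := by
    have := one_add_mul_self_le_rpow_one_add (s := x / y - 1)
      (by have := div_pos hx0 hy0; linarith) hs
    simpa using this
  rw [Real.div_rpow hx0.le hy0.le] at h1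
  have hxs : 0 < x ^ s := Real.rpow_pos_of_pos hx0 s
  have hys : 0 < y ^ s := Real.rpow_pos_of_pos hy0 s
  have hms : 0 < m ^ s := Real.rpow_pos_of_pos hm s
  have h2 : 1 / y ^ s ≤ 1 / x ^ s :=
    one_div_le_one_div_of_le hxs (Real.rpow_le_rpow hx0.le hle (by linarith))
  rw [abs_of_nonneg (by linarith)]
  have h3 : 1 / x ^ s - 1 / y ^ s = 1 / x ^ s * (1 - x ^ s / y ^ s) := by
    field_simp
  have h4 : 1 - x ^ s / y ^ s ≤ s * (1 / m) := by
    have : 1 - x / y ≤ 1 / m := by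
      rw [show 1 - x / y = (y - x) * (1 / y) by field_simp]
      calc (y - x) * (1 / y) ≤ 1 * (1 / m) := by
            gcongr
            rw [abs_sub_comm] at hxy
            exact (le_abs_self _).trans hxy
        _ = 1 / m := one_mul _
    nlinarith
  rw [h3]
  calc 1 / x ^ s * (1 - x ^ s / y ^ s) ≤ 1 / x ^ s * (s * (1 / m)) := by gcongr
    _ ≤ 1 / m ^ s * (s * (1 / m)) := by gcongr
    _ = _ := by ring

/-- The paired series is known for `s > 1`. Dominated convergence carries it to `s = 1`, where it is
half the Mittag-Leffler expansion of `π cot(πa)`. -/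
theorem hurwitzZetaOdd_one {a : ℝ} (ha0 : 0 < a) (ha1 : a < 1) :
    hurwitzZetaOdd a 1 = Real.pi / 2 * cot (Real.pi * a) := by
  have hC : (a : ℂ) ∈ integerComplement := by
    rw [mem_integerComplement_iff]
    rintro ⟨n, hn⟩
    have hn' : (n : ℝ) = a := by exact_mod_cast hn
    have h1 : (0 : ℝ) < n := by rwa [hn']
    have h2 : (n : ℝ) < 1 := by rwa [hn']
    have h3 : 0 < n := by exact_mod_cast h1
    have h4 : n < 1 := by exact_mod_cast h2
    omega
  -- Chosen so that `n + a` and `n + 1 - a` are both at least `δ (n + 1)`.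
  set δ := min a (1 - a) with hδ
  have hδ0 : 0 < δ := lt_min ha0 (by linarith)
  have hδa : δ ≤ a := min_le_left _ _
  have hδb : δ ≤ 1 - a := min_le_right _ _
  set F : ℝ → ℕ → ℝ := fun s n => (1 / (n + a) ^ s - 1 / (n + 1 - a) ^ s) / 2 with hF
  have hbound : ∀ n : ℕ, ∀ s ∈ Set.Icc (1 : ℝ) 2,
      ‖F s n‖ ≤ (1 / δ ^ 3) * (1 / ((n : ℝ) + 1) ^ 2) := by
    intro n s hs
    have hn : (0 : ℝ) ≤ n := n.cast_nonneg
    have hm : 0 < δ * (n + 1) := by positivity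
    have h := abs_rpow_inv_sub_le hm (x := n + a) (y := n + 1 - a) (by nlinarith) (by nlinarith)
      hs.1 (by rw [abs_le]; constructor <;> linarith)
    have h1 : (1 : ℝ) / (δ * (n + 1)) ^ s ≤ 1 / (δ ^ 2 * (n + 1)) := by
      refine one_div_le_one_div_of_le (by positivity) ?_
      rw [Real.mul_rpow hδ0.le (by positivity)]
      have e1 : δ ^ 2 ≤ δ ^ s := by
        rw [← Real.rpow_two]
        exact Real.rpow_le_rpow_of_exponent_ge hδ0 (by linarith) hs.2
      have e2 : ((n : ℝ) + 1) ≤ (n + 1) ^ s := Real.self_le_rpow_of_one_le (by linarith) hs.1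
      exact mul_le_mul e1 e2 (by positivity) (by positivity)
    rw [hF, Real.norm_eq_abs, abs_div, abs_two, div_le_iff₀ two_pos]
    calc |1 / (n + a) ^ s - 1 / (n + 1 - a) ^ s|
        ≤ s * (1 / (δ * (n + 1)) ^ s * (1 / (δ * (n + 1)))) := h
      _ ≤ 2 * (1 / (δ ^ 2 * (n + 1)) * (1 / (δ * (n + 1)))) := by
          gcongr
          exact hs.2
      _ = _ := by
          field_simp
  have hsum : Summable fun n : ℕ => (1 / δ ^ 3) * (1 / ((n : ℝ) + 1) ^ 2) := by
    refine Summable.mul_left _ ?_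
    have := (summable_nat_add_iff 1).2 (Real.summable_one_div_nat_pow.2 one_lt_two)
    simpa using this
  have hlim1 : Tendsto (fun s : ℝ => ∑' n, F s n) (𝓝[>] 1) (𝓝 (∑' n, F 1 n)) := by
    refine tendsto_tsum_of_dominated_convergence hsum (fun n => ?_) ?_
    · have hn : (0 : ℝ) ≤ n := n.cast_nonneg
      have h1 : ContinuousAt (fun s : ℝ => ((n : ℝ) + a) ^ s) 1 :=
        Real.continuousAt_const_rpow (by linarith)
      have h2 : ContinuousAt (fun s : ℝ => ((n : ℝ) + 1 - a) ^ s) 1 :=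
        Real.continuousAt_const_rpow (by linarith)
      have h3 : ContinuousAt (fun s => F s n) 1 := by
        refine ((continuousAt_const.div h1 ?_).sub (continuousAt_const.div h2 ?_)).div_const 2
        · simp only [Real.rpow_one]
          linarith
        · simp only [Real.rpow_one]
          linarith
      exact h3.tendsto.mono_left nhdsWithin_le_nhds
    · filter_upwards [Ioo_mem_nhdsGT one_lt_two] with s hs n
      exact hbound n s ⟨hs.1.le, hs.2.le⟩
  have hlim2 : Tendsto (fun s : ℝ => hurwitzZetaOdd a (s : ℂ)) (𝓝[>] 1)
      (𝓝 (hurwitzZetaOdd a 1)) := by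
    have := ((differentiable_hurwitzZetaOdd (a : UnitAddCircle)).continuous.comp
      continuous_ofReal).tendsto 1
    simpa [Function.comp_def] using this.mono_left nhdsWithin_le_nhds
  have heq : hurwitzZetaOdd a 1 = ((∑' n, F 1 n : ℝ) : ℂ) := by
    refine tendsto_nhds_unique hlim2 (((continuous_ofReal.tendsto _).comp hlim1).congr' ?_)
    filter_upwards [self_mem_nhdsWithin] with s hs
    have h := hasSum_nat_hurwitzZetaOdd_of_mem_Icc (a := a) ⟨ha0.le, ha1.le⟩ (s := s)
      (by simpa using hs)
    rw [← h.tsum_eq, Function.comp_apply, ofReal_tsum]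
    refine tsum_congr fun n => ?_
    have hn : (0 : ℝ) ≤ n := n.cast_nonneg
    simp only [hF]
    push_cast
    rw [ofReal_cpow (by linarith), ofReal_cpow (by linarith)]
    push_cast
    rfl
  have hs1 : Summable (F 1) :=
    Summable.of_norm_bounded hsum fun n => hbound n 1 ⟨le_rfl, one_le_two⟩
  rw [heq]
  have ht1 : Tendsto (fun N : ℕ => ∑ n ∈ Finset.range N, (F 1 n : ℂ)) atTop
      (𝓝 ((∑' n, F 1 n : ℝ) : ℂ)) := by
    have := (continuous_ofReal.tendsto _).comp hs1.hasSum.tendsto_sum_nat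
    simpa [Function.comp_def] using this
  have ht2 := tendsto_logDeriv_euler_cot_sub hC
  -- The two series pair their terms differently: the cotangent partial sum has the extra term `1/(a
  -- + N)`.
  have ht3 : Tendsto (fun N : ℕ => 1 / ((a : ℂ) + N)) atTop (𝓝 0) := by
    have h : Tendsto (fun N : ℕ => 1 / (a + N)) atTop (𝓝 0) :=
      (tendsto_const_nhds (x := (1 : ℝ))).div_atTop
        (tendsto_atTop_add_const_left _ a tendsto_natCast_atTop_atTop)
    have := (continuous_ofReal.tendsto _).comp h
    simpa [Function.comp_def] using this
  refine tendsto_nhds_unique ht1 ?_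
  have ht4 := ((ht2.const_add (1 / (a : ℂ))).sub ht3).div_const 2
  convert! ht4 using 2 with N
  · induction N with
    | zero => simp
    | succ N ih =>
      rw [Finset.sum_range_succ, ih, Finset.sum_range_succ]
      simp only [hF, cotTerm, Real.rpow_one]
      push_cast
      have e : 1 / ((a : ℂ) - (N + 1)) = - (1 / (N + 1 - a)) := by
        rw [← neg_sub, one_div, inv_neg, one_div]
      rw [e, add_comm (N : ℂ) a, ← add_assoc]
      ring
  · ring

theorem sum_range_mul_pow_of_pow_eq_one {z : ℂ} {d : ℕ} (hz : z ^ d = 1) (hz1 : z ≠ 1) :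
    ∑ k ∈ Finset.range d, (k : ℂ) * z ^ k = d / (z - 1) := by
  have hz' : z - 1 ≠ 0 := sub_ne_zero.2 hz1
  have key : ∀ n : ℕ, (∑ k ∈ Finset.range n, (k : ℂ) * z ^ k) * (z - 1) =
      n * z ^ n - z * ∑ k ∈ Finset.range n, z ^ k := by
    intro n
    induction n with
    | zero => simp
    | succ n ih =>
      rw [Finset.sum_range_succ, add_mul, ih, Finset.sum_range_succ]
      push_cast
      ring
  have h0 : ∑ k ∈ Finset.range d, z ^ k = 0 := by
    rw [geom_sum_eq hz1, hz, sub_self, zero_div]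
  rw [eq_div_iff hz', key, h0, hz]
  ring

/-- With `z = e(x/d)` the cotangent is `i (z + 1)/(z - 1) = i + 2i/(z - 1)`, and `d/(z - 1) = ∑ k
z^k` because `z^d = 1`. -/
theorem cot_pi_div_eq {d : ℕ} [NeZero d] {x : ZMod d} (hx : x ≠ 0) :
    cot (Real.pi * ((x.val / d : ℝ) : ℂ)) =
      I + 2 * I / d * ∑ k ∈ Finset.range d, (k : ℂ) * (ZMod.stdAddChar ((k : ZMod d) * x) : ℂ) := by
  have hd0 : (d : ℂ) ≠ 0 := by exact_mod_cast NeZero.ne d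
  have h1 : cexp (2 * Real.pi * I * ((x.val / d : ℝ) : ℂ)) = ZMod.stdAddChar x := by
    have h := ZMod.stdAddChar_coe (N := d) (x.val : ℤ)
    rw [Int.cast_natCast, ZMod.natCast_zmod_val] at h
    rw [h]
    congr 1
    push_cast
    ring
  have hne : (ZMod.stdAddChar x : ℂ) ≠ 1 := by
    rw [← AddChar.map_zero_eq_one (ZMod.stdAddChar (N := d))]
    exact fun h => hx (ZMod.injective_stdAddChar h)
  have hpow : (ZMod.stdAddChar x : ℂ) ^ d = 1 := by
    rw [← AddChar.map_nsmul_eq_pow, nsmul_eq_mul, ZMod.natCast_self, zero_mul,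
      AddChar.map_zero_eq_one]
  have h2 : ∑ k ∈ Finset.range d, (k : ℂ) * (ZMod.stdAddChar ((k : ZMod d) * x) : ℂ) =
      d / (ZMod.stdAddChar x - 1) := by
    rw [← sum_range_mul_pow_of_pow_eq_one hpow hne]
    refine Finset.sum_congr rfl fun k _ => ?_
    rw [← AddChar.map_nsmul_eq_pow, nsmul_eq_mul]
  rw [cot_pi_eq_exp_ratio, h1, h2]
  have h3 : (ZMod.stdAddChar x - 1 : ℂ) ≠ 0 := sub_ne_zero.2 hne
  have h4 : (1 - ZMod.stdAddChar x : ℂ) ≠ 0 := sub_ne_zero.2 hne.symm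
  have hI := I_ne_zero
  generalize (ZMod.stdAddChar x : ℂ) = z at *
  have e : (z + 1) / (I * (1 - z)) = I * ((z + 1) / (z - 1)) := by
    rw [div_eq_iff (mul_ne_zero hI h4)]
    field_simp
    linear_combination (z ^ 2 - 1) * I_sq
  rw [e]
  field_simp
  ring

/-- As `χ` is odd, only odd Hurwitz values, hence cotangents, occur. Their constant term `i` dies
against `∑ χ = 0`; exchanging sums leaves Gauss sums `χ(k) i√d`, and `i² = -1` gives the sign. -/
theorem LFunction_jacobiChar_one {d : ℕ} [NeZero d] (hd : Squarefree d) (h4 : d % 4 = 3) :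
    DirichletCharacter.LFunction (jacobiChar d) 1 =
      ((-(Real.pi * Real.sqrt d / d ^ 2) *
        ((∑ b ∈ Finset.range d, (b : ℤ) * J(b | d) : ℤ) : ℝ) : ℝ) : ℂ) := by
  have hd0 : (d : ℂ) ≠ 0 := by exact_mod_cast NeZero.ne d
  have hodd : Odd d := Nat.odd_iff.2 (by omega)
  have hd1 : d ≠ 1 := by rintro rfl; omega
  have hfun : Function.Odd (jacobiChar d : ZMod d → ℂ) := fun x => jacobiChar_neg h4 x
  have : Fact (1 < d) := ⟨by omega⟩
  have hterm : ∀ x : ZMod d, jacobiChar d x * hurwitzZetaOdd (ZMod.toAddCircle x) 1 =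
      Real.pi / 2 * I * jacobiChar d x + Real.pi * I / d *
        ∑ k ∈ Finset.range d, (k : ℂ) *
          (jacobiChar d x * (ZMod.stdAddChar ((k : ZMod d) * x) : ℂ)) := by
    intro x
    rcases eq_or_ne x 0 with rfl | hx
    · simp [MulChar.map_zero]
    · have hval : 0 < x.val := Nat.pos_of_ne_zero fun h => hx ((ZMod.val_eq_zero x).1 h)
      have hdpos : (0 : ℝ) < d := by exact_mod_cast NeZero.pos d
      rw [ZMod.toAddCircle_apply, hurwitzZetaOdd_one (div_pos (by exact_mod_cast hval) hdpos)
        ((div_lt_one hdpos).2 (by exact_mod_cast x.val_lt)), cot_pi_div_eq hx, Finset.mul_sum,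
        Finset.mul_sum, mul_add, mul_add, Finset.mul_sum, Finset.mul_sum]
      congr 1
      · ring
      · refine Finset.sum_congr rfl fun k _ => ?_
        field_simp
  have hsum0 : ∑ x : ZMod d, jacobiChar d x = 0 :=
    MulChar.sum_eq_zero_of_ne_one (jacobiChar_ne_one hodd hd hd1)
  have hin : ∑ k ∈ Finset.range d, ∑ x : ZMod d, (k : ℂ) *
      (jacobiChar d x * (ZMod.stdAddChar ((k : ZMod d) * x) : ℂ)) =
      (∑ k ∈ Finset.range d, (k : ℂ) * (J(k | d) : ℂ)) * (I * Real.sqrt d) := by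
    rw [Finset.sum_mul]
    refine Finset.sum_congr rfl fun k _ => ?_
    rw [← Finset.mul_sum, sum_jacobi_mul_stdAddChar_mul hd h4, jacobiChar_natCast, mul_assoc]
  rw [DirichletCharacter.LFunction, ZMod.LFunction_def_odd hfun, Finset.sum_congr rfl
    fun x _ => hterm x, Finset.sum_add_distrib, ← Finset.mul_sum, hsum0, ← Finset.mul_sum,
    Finset.sum_comm]
  rw [hin]
  rw [cpow_neg_one]
  push_cast
  field_simp
  linear_combination (2 * Real.sqrt d * ∑ b ∈ Finset.range d, (b : ℂ) * (J(b | d) : ℂ)) * I_sq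

end LValue

/-! ### The ring of integers of the imaginary quadratic field -/

noncomputable section RingOfIntegers

open NumberField ComplexConjugate

/-- The square root of `-d` as an element of `ℚ(√(-d))`. -/
def imaginaryQuadraticField.sqrt (d : ℕ) : imaginaryQuadraticField d :=
  ⟨sqrtNeg d, IntermediateField.mem_adjoin_simple_self ℚ _⟩

open imaginaryQuadraticField (sqrt)

theorem imaginaryQuadraticField.sqrt_mul_self (d : ℕ) :
    sqrt d * sqrt d = -(d : imaginaryQuadraticField d) := by
  apply Subtype.ext
  have := sqrtNeg_sq d
  rw [sq] at this
  simpa [imaginaryQuadraticField.sqrt] using this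

theorem exists_rat_eq_add_mul_sqrtNeg {d : ℕ} {x : ℂ} (hx : x ∈ imaginaryQuadraticField d) :
    ∃ u v : ℚ, x = u + v * sqrtNeg d := by
  have h : x ∈ Algebra.adjoin ℚ {sqrtNeg d} := by
    rw [← IntermediateField.adjoin_simple_toSubalgebra_of_isAlgebraic
      (isIntegral_sqrtNeg d).isAlgebraic]
    exact hx
  clear hx
  induction h using Algebra.adjoin_induction with
  | mem x hx =>
    rw [Set.mem_singleton_iff] at hx
    exact ⟨0, 1, by simp [hx]⟩
  | algebraMap r => exact ⟨r, 0, by simp⟩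
  | add x y hx hy h1 h2 =>
    obtain ⟨u, v, h1⟩ := h1
    obtain ⟨u', v', h2⟩ := h2
    exact ⟨u + u', v + v', by rw [h1, h2]; push_cast; ring⟩
  | mul x y hx hy h1 h2 =>
    obtain ⟨u, v, h1⟩ := h1
    obtain ⟨u', v', h2⟩ := h2
    refine ⟨u * u' - d * v * v', u * v' + v * u', ?_⟩
    rw [h1, h2]
    push_cast
    linear_combination (v : ℂ) * v' * sqrtNeg_sq d

theorem conj_sqrtNeg (d : ℕ) : conj (sqrtNeg d) = -sqrtNeg d := by
  simp [sqrtNeg]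

theorem Rat.exists_intCast_of_isIntegral_complex {q : ℚ} (h : IsIntegral ℤ (q : ℂ)) :
    ∃ m : ℤ, q = m := by
  have h' : IsIntegral ℤ q := by
    rwa [← isIntegral_algebraMap_iff (B := ℂ) (algebraMap ℚ ℂ).injective]
  obtain ⟨m, hm⟩ := IsIntegrallyClosed.isIntegral_iff.mp h'
  exact ⟨m, by simpa using hm.symm⟩

theorem exists_intCast_of_natCast_mul_sq {d : ℕ} (hd : Squarefree d) {w : ℚ} {k : ℤ}
    (h : d * w ^ 2 = k) : ∃ m : ℤ, w = m := by
  have hd0 : (d : ℚ) ≠ 0 := by exact_mod_cast hd.ne_zero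
  have h1 : IsIntegral ℤ (d * w) := by
    refine IsIntegral.of_pow (n := 2) two_pos ?_
    have : (d * w) ^ 2 = ((d * k : ℤ) : ℚ) := by push_cast; rw [← h]; ring
    rw [this]
    exact isIntegral_algebraMap (R := ℤ) (A := ℚ)
  obtain ⟨t, ht⟩ := IsIntegrallyClosed.isIntegral_iff.mp h1
  have ht : (t : ℚ) = d * w := by simpa using ht
  have h2 : t ^ 2 = d * k := by
    have : (t : ℚ) ^ 2 = d * k := by rw [ht, ← h]; ring
    exact_mod_cast this
  have h3 : (d : ℤ) ∣ t :=
    (Int.squarefree_natCast.mpr hd).isRadical 2 t ⟨k, h2⟩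
  obtain ⟨m, rfl⟩ := h3
  refine ⟨m, ?_⟩
  push_cast at ht
  exact (mul_left_cancel₀ hd0 ht).symm

/-- For `x = u + v√(-d)`, the trace `2u` and the norm `u² + d v²` are integers, whence `d (2v)²` is
one and, `d` being squarefree, so is `2v`. Since `d` is odd, the norm equation forces `2u` and `2v`
to have the same parity. -/
theorem exists_int_eq_add_mul_of_isIntegral {d : ℕ} (hd : Squarefree d) (h4 : d % 4 = 3) {x : ℂ}
    (hx : x ∈ imaginaryQuadraticField d) (hint : IsIntegral ℤ x) :
    ∃ m n : ℤ, x = m + n * ((1 + sqrtNeg d) / 2) := by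
  obtain ⟨u, v, rfl⟩ := exists_rat_eq_add_mul_sqrtNeg hx
  have hconj : conj ((u : ℂ) + v * sqrtNeg d) = u - v * sqrtNeg d := by
    simp [conj_sqrtNeg, sub_eq_add_neg]
  have hint' : IsIntegral ℤ ((u : ℂ) - v * sqrtNeg d) := by
    rw [← hconj]
    exact hint.map (Complex.conjAe.toAlgHom.restrictScalars ℤ)
  have hsum := hint.add hint'
  have hmul := hint.mul hint'
  rw [show (u : ℂ) + v * sqrtNeg d + (u - v * sqrtNeg d) = ((2 * u : ℚ) : ℂ) by
    push_cast; ring] at hsum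
  rw [show ((u : ℂ) + v * sqrtNeg d) * (u - v * sqrtNeg d) = ((u ^ 2 + d * v ^ 2 : ℚ) : ℂ) by
    push_cast; linear_combination (-(v : ℂ) ^ 2) * sqrtNeg_sq d] at hmul
  obtain ⟨m, hm⟩ := Rat.exists_intCast_of_isIntegral_complex hsum
  obtain ⟨n, hn⟩ := Rat.exists_intCast_of_isIntegral_complex hmul
  obtain ⟨w, hw⟩ := exists_intCast_of_natCast_mul_sq hd (w := 2 * v) (k := 4 * n - m ^ 2) (by
    push_cast; rw [← hn, ← hm]; ring)
  have hu : u = m / 2 := by linarith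
  have hv : v = w / 2 := by linarith
  have hpar : m ^ 2 + d * w ^ 2 = 4 * n := by
    have : (m : ℚ) ^ 2 + d * w ^ 2 = 4 * n := by rw [← hn, hu, hv]; ring
    exact_mod_cast this
  have hpar' : (2 : ℤ) ∣ m - w := by
    have hodd : ¬ (2 : ℤ) ∣ d := by omega
    have : (2 : ℤ) ∣ m ^ 2 + d * w ^ 2 := ⟨2 * n, by rw [hpar]; ring⟩
    rw [← even_iff_two_dvd] at *
    simpa [hodd, parity_simps] using this
  obtain ⟨k, hk⟩ := hpar'
  refine ⟨k, w, ?_⟩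
  have hk' : (m : ℂ) = 2 * k + w := by
    have : m = 2 * k + w := by linarith
    exact_mod_cast this
  rw [hu, hv]
  push_cast
  rw [hk']
  ring

variable {d c : ℕ}

theorem half_one_add_sqrtNeg_mul_self (hc : d + 1 = 4 * c) :
    ((1 + sqrtNeg d) / 2) * ((1 + sqrtNeg d) / 2) =
      (1 + sqrtNeg d) / 2 - (c : ℂ) := by
  have h : (d : ℂ) + 1 = 4 * (c : ℂ) := by exact_mod_cast hc
  linear_combination (1 / 4 : ℂ) * sqrtNeg_sq d - (1 / 4 : ℂ) * h

/-- The algebraic integer `(1 + √(-d)) / 2`, for `d ≡ 3` modulo `4`. -/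
def imaginaryQuadraticField.theta (hc : d + 1 = 4 * c) : 𝓞 (imaginaryQuadraticField d) :=
  ⟨(1 + sqrt d) / 2, by
    have : IsIntegral ℤ ((1 + sqrtNeg d) / 2) := by
      refine ⟨Polynomial.X ^ 2 - Polynomial.X + Polynomial.C (c : ℤ), ?_, ?_⟩
      · monicity!
      · simp [sq, half_one_add_sqrtNeg_mul_self hc]
    rw [mem_integralClosure_iff]
    rw [← isIntegral_algebraMap_iff (B := ℂ) (algebraMap (imaginaryQuadraticField d) ℂ).injective]
    exact this⟩

open imaginaryQuadraticField (theta)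

theorem coe_coe_theta (hc : d + 1 = 4 * c) :
    (((theta hc : 𝓞 (imaginaryQuadraticField d)) : imaginaryQuadraticField d) : ℂ) =
      (1 + sqrtNeg d) / 2 := rfl

theorem ringOfIntegers_ext {x y : 𝓞 (imaginaryQuadraticField d)}
    (h : ((x : imaginaryQuadraticField d) : ℂ) = ((y : imaginaryQuadraticField d) : ℂ)) : x = y :=
  RingOfIntegers.ext (Subtype.ext h)

theorem theta_mul_self (hc : d + 1 = 4 * c) :
    theta hc * theta hc = (-(c : ℤ)) • 1 + (1 : ℤ) • theta hc := by
  apply ringOfIntegers_ext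
  simp only [map_mul, map_add, one_smul, MulMemClass.coe_mul, AddMemClass.coe_add, coe_coe_theta,
    half_one_add_sqrtNeg_mul_self hc]
  simp
  ring

/-- The ring of integers of `ℚ(√(-d))` is `ℤ[θ]` with `θ² = θ - c`, where `c = (d + 1) / 4`. -/
def quadraticAlgebraEquiv (hd : Squarefree d) (hc : d + 1 = 4 * c) :
    QuadraticAlgebra ℤ (-(c : ℤ)) 1 ≃ₐ[ℤ] 𝓞 (imaginaryQuadraticField d) :=
  AlgEquiv.ofBijective (QuadraticAlgebra.lift ⟨theta hc, theta_mul_self hc⟩) (by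
    have key : ∀ z, (((QuadraticAlgebra.lift ⟨theta hc, theta_mul_self hc⟩ z :
        𝓞 (imaginaryQuadraticField d)) : imaginaryQuadraticField d) : ℂ) =
          z.re + z.im * ((1 + sqrtNeg d) / 2) := by
      intro z
      simp [QuadraticAlgebra.lift, coe_coe_theta]
    constructor
    · rw [injective_iff_map_eq_zero]
      intro z hz
      have h := key z
      rw [hz] at h
      have him := congrArg Complex.im h
      have hre := congrArg Complex.re h
      have hd0 : (0 : ℝ) < d := by exact_mod_cast hd.ne_zero.bot_lt
      have h1 : z.im = 0 := by
        have := (Real.sqrt_pos.mpr hd0).ne'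
        simpa [sqrtNeg, this] using him
      have h2 : z.re = 0 := by
        simpa [h1] using hre.symm
      ext <;> simp [h1, h2]
    · intro x
      obtain ⟨m, n, h⟩ := exists_int_eq_add_mul_of_isIntegral hd (by omega)
        (x : imaginaryQuadraticField d).2
        (x.isIntegral_coe.map (IsScalarTower.toAlgHom ℤ (imaginaryQuadraticField d) ℂ))
      refine ⟨⟨m, n⟩, ringOfIntegers_ext ?_⟩
      rw [key, h])

end RingOfIntegers

/-! ### Discriminant, places, regulator and units -/

noncomputable section Invariants

open NumberField

variable {d c : ℕ}

theorem QuadraticAlgebra.basis_zero {R : Type*} [CommRing R] (a b : R) :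
    basis a b 0 = ⟨1, 0⟩ := by
  apply (basis a b).repr.injective
  ext i; fin_cases i <;> simp

theorem QuadraticAlgebra.basis_one {R : Type*} [CommRing R] (a b : R) :
    basis a b 1 = ⟨0, 1⟩ := by
  apply (basis a b).repr.injective
  ext i; fin_cases i <;> simp

theorem QuadraticAlgebra.algebra_trace_eq {R : Type*} [CommRing R] {a b : R}
    (z : QuadraticAlgebra R a b) :
    Algebra.trace R (QuadraticAlgebra R a b) z = 2 * z.re + b * z.im := by
  rw [Algebra.trace_eq_matrix_trace (basis a b), Matrix.trace_fin_two]
  simp [Algebra.leftMulMatrix_eq_repr_mul, basis_zero, basis_one]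
  ring

theorem discr_imaginaryQuadraticField (hd : Squarefree d) (hc : d + 1 = 4 * c) :
    discr (imaginaryQuadraticField d) = -d := by
  rw [← discr_eq_discr (imaginaryQuadraticField d)
    ((QuadraticAlgebra.basis (-(c : ℤ)) 1).map (quadraticAlgebraEquiv hd hc).toLinearEquiv)]
  have h : (⇑((QuadraticAlgebra.basis (-(c : ℤ)) 1).map
      (quadraticAlgebraEquiv hd hc).toLinearEquiv)) =
      quadraticAlgebraEquiv hd hc ∘ QuadraticAlgebra.basis (-(c : ℤ)) 1 := by
    ext i; simp
  rw [h, ← Algebra.discr_eq_discr_of_algEquiv, Algebra.discr_def, Matrix.det_fin_two]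
  simp only [Algebra.traceMatrix_apply, Algebra.traceForm_apply,
    QuadraticAlgebra.basis_zero, QuadraticAlgebra.basis_one, QuadraticAlgebra.algebra_trace_eq]
  simp
  have : (d : ℤ) + 1 = 4 * c := by exact_mod_cast hc
  linarith

theorem finrank_imaginaryQuadraticField (hd : Squarefree d) (hc : d + 1 = 4 * c) :
    Module.finrank ℚ (imaginaryQuadraticField d) = 2 := by
  rw [← RingOfIntegers.rank, ← (quadraticAlgebraEquiv hd hc).toLinearEquiv.finrank_eq,
    QuadraticAlgebra.finrank_eq_two]

theorem nrRealPlaces_imaginaryQuadraticField (hd : 0 < d) :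
    InfinitePlace.nrRealPlaces (imaginaryQuadraticField d) = 0 := by
  classical
  rw [InfinitePlace.nrRealPlaces, Fintype.card_eq_zero_iff]
  refine ⟨fun ⟨w, hw⟩ => ?_⟩
  let φ := InfinitePlace.embedding_of_isReal hw
  have h := congrArg φ (imaginaryQuadraticField.sqrt_mul_self d)
  rw [map_mul, map_neg, map_natCast] at h
  have := mul_self_nonneg (φ (imaginaryQuadraticField.sqrt d))
  have : (0 : ℝ) < d := by exact_mod_cast hd
  linarith

theorem nrComplexPlaces_imaginaryQuadraticField (hd : Squarefree d) (hc : d + 1 = 4 * c) :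
    InfinitePlace.nrComplexPlaces (imaginaryQuadraticField d) = 1 := by
  have h := InfinitePlace.card_add_two_mul_card_eq_rank (imaginaryQuadraticField d)
  rw [nrRealPlaces_imaginaryQuadraticField hd.ne_zero.bot_lt,
    finrank_imaginaryQuadraticField hd hc] at h
  omega

open scoped Classical in
theorem regulator_imaginaryQuadraticField (hd : Squarefree d) (hc : d + 1 = 4 * c) :
    Units.regulator (imaginaryQuadraticField d) = 1 := by
  have h1 : Fintype.card (InfinitePlace (imaginaryQuadraticField d)) = 1 := by
    rw [InfinitePlace.card_eq_nrRealPlaces_add_nrComplexPlaces,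
      nrRealPlaces_imaginaryQuadraticField hd.ne_zero.bot_lt,
      nrComplexPlaces_imaginaryQuadraticField hd hc]
  have h0 : Units.rank (imaginaryQuadraticField d) = 0 := by rw [Units.rank, h1]
  obtain ⟨w, hw⟩ := Fintype.card_eq_one_iff.mp h1
  have : IsEmpty {w' : InfinitePlace (imaginaryQuadraticField d) // w' ≠ w} :=
    ⟨fun v => v.2 (hw v)⟩
  have e : {w' : InfinitePlace (imaginaryQuadraticField d) // w' ≠ w} ≃
      Fin (Units.rank (imaginaryQuadraticField d)) :=
    (Equiv.equivEmpty _).trans (by rw [h0]; exact (Equiv.equivEmpty _).symm)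
  rw [Units.regulator_eq_det _ w e, Matrix.det_isEmpty, abs_one]

theorem card_units_imaginaryQuadraticField (hd : Squarefree d) (hc : d + 1 = 4 * c) :
    Nat.card (𝓞 (imaginaryQuadraticField d))ˣ =
      {z : ℤ × ℤ | (2 * z.1 + z.2) ^ 2 + d * z.2 ^ 2 = 4}.ncard := by
  have hc' : (d : ℤ) + 1 = 4 * c := by exact_mod_cast hc
  rw [← Nat.card_congr (Units.mapEquiv (quadraticAlgebraEquiv hd hc).toMulEquiv).toEquiv]
  have key : ∀ z : QuadraticAlgebra ℤ (-(c : ℤ)) 1,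
      IsUnit z ↔ (2 * z.re + z.im) ^ 2 + d * z.im ^ 2 = 4 := by
    intro z
    -- Completing the square shows the norm is nonnegative, so units are exactly the elements of
    -- norm `1`.
    have h4 : (2 * z.re + z.im) ^ 2 + d * z.im ^ 2 = 4 * z.norm := by
      rw [QuadraticAlgebra.norm_def]
      linear_combination z.im ^ 2 * hc'
    rw [QuadraticAlgebra.isUnit_iff_norm_isUnit, h4, Int.isUnit_iff]
    have : 0 ≤ 4 * z.norm := by rw [← h4]; positivity
    omega
  rw [← Nat.card_coe_set_eq]
  refine Nat.card_congr (Equiv.ofBijective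
    (fun u => ⟨((u : QuadraticAlgebra ℤ (-(c : ℤ)) 1).re,
      (u : QuadraticAlgebra ℤ (-(c : ℤ)) 1).im), (key _).mp u.isUnit⟩) ⟨?_, ?_⟩)
  · intro u v h
    rw [Subtype.mk.injEq, Prod.mk.injEq] at h
    exact Units.ext (QuadraticAlgebra.ext h.1 h.2)
  · rintro ⟨⟨x, y⟩, h⟩
    obtain ⟨u, hu⟩ := (key ⟨x, y⟩).mpr h
    exact ⟨u, by simp [hu]⟩

theorem ncard_norm_eq_one (h4 : d % 4 = 3) :
    {z : ℤ × ℤ | (2 * z.1 + z.2) ^ 2 + d * z.2 ^ 2 = 4}.ncard = if d = 3 then 6 else 2 := by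
  split_ifs with h3
  · have : {z : ℤ × ℤ | (2 * z.1 + z.2) ^ 2 + d * z.2 ^ 2 = 4} =
        (({(1, 0), (-1, 0), (0, 1), (0, -1), (1, -1), (-1, 1)} : Finset (ℤ × ℤ)) :
          Set (ℤ × ℤ)) := by
      ext ⟨x, y⟩
      simp only [Set.mem_ofPred_eq, Finset.coe_insert, Finset.coe_singleton,
        Set.mem_insert_iff, Set.mem_singleton_iff, Prod.mk.injEq, h3]
      push_cast
      constructor
      · intro h
        have hy1 : y ≤ 1 := by nlinarith [sq_nonneg (2 * x + y)]
        have hy2 : -1 ≤ y := by nlinarith [sq_nonneg (2 * x + y)]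
        -- For `d = 3` the form is also `(x + 2y)² + 3x²`.
        have hx1 : x ≤ 1 := by nlinarith [sq_nonneg (x + 2 * y)]
        have hx2 : -1 ≤ x := by nlinarith [sq_nonneg (x + 2 * y)]
        interval_cases x <;> interval_cases y <;> simp_all
      · rintro (h | h | h | h | h | h) <;> rw [h.1, h.2] <;> norm_num
    rw [this, Set.ncard_coe_finset]
    rfl
  · have : {z : ℤ × ℤ | (2 * z.1 + z.2) ^ 2 + d * z.2 ^ 2 = 4} = {(1, 0), (-1, 0)} := by
      ext ⟨x, y⟩
      simp only [Set.mem_ofPred_eq, Set.mem_insert_iff, Set.mem_singleton_iff, Prod.mk.injEq]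
      have hd7 : (7 : ℤ) ≤ d := by omega
      constructor
      · intro h
        have hy : y = 0 := by
          by_contra hy
          have : 1 ≤ y ^ 2 := by
            have := sq_pos_of_ne_zero hy
            omega
          nlinarith [sq_nonneg (2 * x + y)]
        subst hy
        have : x ^ 2 = 1 := by linarith
        rcases mul_self_eq_one_iff.mp ((sq x).symm.trans this) with h | h <;> simp [h]
      · rintro (h | h) <;> rw [h.1, h.2] <;> norm_num
    rw [this, Set.ncard_pair (by simp)]

theorem torsionOrder_imaginaryQuadraticField (hd : Squarefree d) (hc : d + 1 = 4 * c) :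
    Units.torsionOrder (imaginaryQuadraticField d) = if d = 3 then 6 else 2 := by
  have h := (card_units_imaginaryQuadraticField hd hc).trans (ncard_norm_eq_one (by omega))
  have : Finite (𝓞 (imaginaryQuadraticField d))ˣ :=
    Nat.finite_of_card_ne_zero (by rw [h]; split_ifs <;> norm_num)
  have htop : Units.torsion (imaginaryQuadraticField d) = ⊤ :=
    eq_top_iff.mpr fun x _ => isOfFinOrder_of_finite x
  rw [← h, Units.torsionOrder, htop]
  exact Nat.card_congr Subgroup.topEquiv.toEquiv

theorem dedekindZeta_residue_imaginaryQuadraticField (hd : Squarefree d) (hc : d + 1 = 4 * c) :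
    dedekindZeta_residue (imaginaryQuadraticField d) =
      Real.pi / Real.sqrt d * (classWeight d * classNumberNeg d) := by
  rw [dedekindZeta_residue_def, nrRealPlaces_imaginaryQuadraticField hd.ne_zero.bot_lt,
    nrComplexPlaces_imaginaryQuadraticField hd hc, regulator_imaginaryQuadraticField hd hc,
    torsionOrder_imaginaryQuadraticField hd hc, discr_imaginaryQuadraticField hd hc]
  have : |((-(d : ℤ) : ℤ) : ℝ)| = d := by simp
  rw [this, classNumberNeg, classWeight]
  have : Real.sqrt d ≠ 0 := (Real.sqrt_pos.mpr (by exact_mod_cast hd.ne_zero.bot_lt)).ne'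
  split_ifs <;> (push_cast; field_simp; try ring)

end Invariants

/-! ### Counting ideals of given norm in rank two -/

section IdealCount

open Ideal

variable {S : Type*} [CommRing S] [IsDedekindDomain S] [Module.Free ℤ S]

theorem Ideal.eq_of_dvd_of_absNorm_eq {I J : Ideal S} (h : I ∣ J) (hn : absNorm I = absNorm J)
    (h0 : absNorm I ≠ 0) : I = J := by
  obtain ⟨X, rfl⟩ := h
  rw [map_mul] at hn
  have : absNorm X = 1 := (Nat.eq_of_mul_eq_mul_left h0.bot_lt (by rwa [mul_one])).symm
  rw [absNorm_eq_one_iff.mp this, Ideal.mul_top]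

theorem Ideal.isCoprime_of_coprime_absNorm [CharZero S] {I J : Ideal S}
    (h : (absNorm I).Coprime (absNorm J)) : IsCoprime I J := by
  rw [Ideal.isCoprime_iff_exists]
  obtain ⟨u, v, huv⟩ := (Nat.isCoprime_iff_coprime.mpr h)
  refine ⟨u * absNorm I, I.mul_mem_left _ (absNorm_mem I), v * absNorm J,
    J.mul_mem_left _ (absNorm_mem J), ?_⟩
  exact_mod_cast congrArg (Int.cast : ℤ → S) huv

theorem Ideal.dvd_span_absNorm (I : Ideal S) : I ∣ span {(absNorm I : S)} := by
  rw [Ideal.dvd_span_singleton]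
  exact absNorm_mem I

theorem Ideal.exists_dvd_of_absNorm_eq_prime_pow {p : ℕ} (hp : p.Prime) {L : Ideal S} {k : ℕ}
    (hL : absNorm L = p ^ (k + 1)) :
    ∃ Q : Ideal S, Q ∣ L ∧ Q ∣ span {(p : S)} ∧ absNorm Q ≠ 1 := by
  have hne : L ≠ ⊤ := by
    rintro rfl
    rw [absNorm_top] at hL
    exact (Nat.one_lt_pow k.succ_ne_zero hp.one_lt).ne hL
  obtain ⟨Q, hQ, hLQ⟩ := exists_le_maximal L hne
  refine ⟨Q, Ideal.dvd_iff_le.mpr hLQ, ?_, by rw [Ne, absNorm_eq_one_iff]; exact hQ.ne_top⟩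
  rw [Ideal.dvd_span_singleton]
  have := hLQ (absNorm_mem L)
  rw [hL, Nat.cast_pow] at this
  exact hQ.isPrime.mem_of_pow_mem _ this

variable [Module.Finite ℤ S]

theorem Ideal.card_absNorm_mul [CharZero S] {m n : ℕ} (hmn : m.Coprime n) (hm : m ≠ 0) (hn : n ≠ 0) :
    Nat.card {I : Ideal S // absNorm I = m * n} =
      Nat.card {I : Ideal S // absNorm I = m} * Nat.card {I : Ideal S // absNorm I = n} := by
  rw [← Nat.card_prod]
  symm
  refine Nat.card_congr (Equiv.ofBijective
    (fun x => ⟨x.1.1 * x.2.1, by rw [map_mul, x.1.2, x.2.2]⟩) ⟨?_, ?_⟩)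
  · rintro ⟨⟨I, hI⟩, ⟨J, hJ⟩⟩ ⟨⟨I', hI'⟩, ⟨J', hJ'⟩⟩ h
    have h : I * J = I' * J' := congrArg Subtype.val h
    have h1 : I = I' := eq_of_dvd_of_absNorm_eq
      ((isCoprime_of_coprime_absNorm (by rwa [hI, hJ'])).dvd_of_dvd_mul_right
        (h ▸ dvd_mul_right I J)) (hI.trans hI'.symm) (hI ▸ hm)
    have h2 : J = J' := eq_of_dvd_of_absNorm_eq
      ((isCoprime_of_coprime_absNorm (by rw [hJ, hI']; exact hmn.symm)).dvd_of_dvd_mul_left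
        (h ▸ dvd_mul_left J I)) (hJ.trans hJ'.symm) (hJ ▸ hn)
    subst h1 h2
    rfl
  · rintro ⟨L, hL⟩
    have hdvd : L ∣ span {(m : S)} * span {(n : S)} := by
      rw [span_singleton_mul_span_singleton, ← Nat.cast_mul, ← hL]
      exact dvd_span_absNorm L
    -- The norms of `I` and `J` divide powers of `m` and `n`; coprimality then forces them to equal
    -- `m` and `n`.
    obtain ⟨I, J, hI, hJ, rfl⟩ := exists_dvd_and_dvd_of_dvd_mul hdvd
    have hI' := map_dvd absNorm hI
    have hJ' := map_dvd absNorm hJ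
    rw [absNorm_span_natCast] at hI' hJ'
    rw [map_mul] at hL
    have h1 : absNorm I ∣ m :=
      ((hmn.pow_left _).coprime_dvd_left hI').dvd_of_dvd_mul_right (hL ▸ dvd_mul_right _ _)
    have h2 : absNorm J ∣ n :=
      ((hmn.symm.pow_left _).coprime_dvd_left hJ').dvd_of_dvd_mul_left (hL ▸ dvd_mul_left _ _)
    have h3 : absNorm I = m := by
      refine h1.antisymm (Nat.dvd_of_mul_dvd_mul_right hn.bot_lt ?_)
      rw [← hL]
      exact Nat.mul_dvd_mul_left _ h2
    have h4 : absNorm J = n := by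
      rw [h3] at hL
      exact Nat.eq_of_mul_eq_mul_left hm.bot_lt hL
    exact ⟨⟨⟨I, h3⟩, ⟨J, h4⟩⟩, rfl⟩

variable {p : ℕ}

theorem Ideal.absNorm_eq_or_eq_span
    (hrank : Module.finrank ℤ S = 2) (hp : p.Prime) {Q : Ideal S} (h : Q ∣ span {(p : S)})
    (h1 : absNorm Q ≠ 1) :
    absNorm Q = p ∨ Q = span {(p : S)} := by
  have h2 := map_dvd absNorm h
  rw [absNorm_span_natCast, hrank, Nat.dvd_prime_pow hp] at h2
  obtain ⟨i, hi, h2⟩ := h2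
  interval_cases i
  · simp_all
  · left; simpa using h2
  · right
    refine eq_of_dvd_of_absNorm_eq h ?_ ?_
    · rw [absNorm_span_natCast, hrank, h2]
    · rw [h2]; exact pow_ne_zero _ hp.ne_zero

/-- A maximal ideal above `L` has norm `p` or is `(p)` itself; in the latter case `P`, which divides
`(p)`, serves instead. -/
theorem Ideal.exists_dvd_of_absNorm_eq_prime
    (hrank : Module.finrank ℤ S = 2) (hp : p.Prime) {P L : Ideal S} (h : absNorm P = p) {k : ℕ}
    (hL : absNorm L = p ^ (k + 1)) :
    ∃ (Q L' : Ideal S), absNorm Q = p ∧ absNorm L' = p ^ k ∧ L = Q * L' := by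
  have key : ∃ Q : Ideal S, absNorm Q = p ∧ Q ∣ L := by
    obtain ⟨Q, hQL, hQp, hQ1⟩ := exists_dvd_of_absNorm_eq_prime_pow hp hL
    rcases absNorm_eq_or_eq_span hrank hp hQp hQ1 with hQ | hQ
    · exact ⟨Q, hQ, hQL⟩
    · refine ⟨P, h, dvd_trans ?_ hQL⟩
      rw [hQ, ← h]
      exact dvd_span_absNorm P
  obtain ⟨Q, hQ, L', rfl⟩ := key
  refine ⟨Q, L', hQ, ?_, rfl⟩
  rw [map_mul, hQ, pow_succ'] at hL
  exact Nat.eq_of_mul_eq_mul_left hp.pos hL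

/-- Without ideals of norm `p`, every ideal of norm `p^(k+2)` is divisible by `(p)`, so
multiplication by `(p)` is a bijection. -/
theorem Ideal.ncard_absNorm_prime_pow_of_inert [CharZero S]
    (hrank : Module.finrank ℤ S = 2) (hp : p.Prime)
    (h : {P : Ideal S | absNorm P = p} = ∅) (k : ℕ) :
    {I : Ideal S | absNorm I = p ^ (k + 2)}.ncard = {I : Ideal S | absNorm I = p ^ k}.ncard := by
  have hinj : Function.Injective (fun I : Ideal S => span {(p : S)} * I) := by
    intro I J hIJ
    refine mul_left_cancel₀ ?_ hIJ
    rw [Ne, Ideal.zero_eq_bot, span_singleton_eq_bot]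
    exact_mod_cast hp.ne_zero
  rw [← Set.ncard_image_of_injective {I : Ideal S | absNorm I = p ^ k} hinj]
  congr 1
  ext L
  simp only [Set.mem_ofPred_eq, Set.mem_image]
  constructor
  · intro hL
    obtain ⟨Q, hQL, hQp, hQ1⟩ := exists_dvd_of_absNorm_eq_prime_pow hp (k := k + 1) hL
    rcases absNorm_eq_or_eq_span hrank hp hQp hQ1 with hQ | rfl
    · have : Q ∈ {P : Ideal S | absNorm P = p} := hQ
      simp [h] at this
    · obtain ⟨I, rfl⟩ := hQL
      refine ⟨I, ?_, rfl⟩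
      rw [map_mul, absNorm_span_natCast, hrank, add_comm, pow_add] at hL
      exact Nat.eq_of_mul_eq_mul_left (pow_pos hp.pos 2) hL
  · rintro ⟨I, hI, rfl⟩
    rw [map_mul, absNorm_span_natCast, hrank, hI, ← pow_add, add_comm]

theorem Ideal.ncard_absNorm_prime_pow_of_ramified
    (hrank : Module.finrank ℤ S = 2) (hp : p.Prime) {P : Ideal S}
    (h : {P : Ideal S | absNorm P = p} = {P}) (k : ℕ) :
    {I : Ideal S | absNorm I = p ^ k}.ncard = 1 := by
  have hP : absNorm P = p := by
    have : P ∈ {P : Ideal S | absNorm P = p} := by rw [h]; rfl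
    exact this
  rw [Set.ncard_eq_one]
  refine ⟨P ^ k, Set.eq_singleton_iff_unique_mem.mpr ⟨by simp [hP], ?_⟩⟩
  induction k with
  | zero => intro L hL; simpa [absNorm_eq_one_iff] using hL
  | succ k ih =>
    intro L hL
    obtain ⟨Q, L', hQ, hL', rfl⟩ := exists_dvd_of_absNorm_eq_prime hrank hp hP hL
    have hQ' : Q ∈ {P : Ideal S | absNorm P = p} := hQ
    rw [h, Set.mem_singleton_iff] at hQ'
    rw [ih L' hL', hQ', pow_succ']

theorem Ideal.ncard_absNorm_prime_pow_of_split
    (hrank : Module.finrank ℤ S = 2) (hp : p.Prime) {P P' : Ideal S} (hne : P ≠ P')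
    (h : {P : Ideal S | absNorm P = p} = {P, P'}) (k : ℕ) :
    {I : Ideal S | absNorm I = p ^ k}.ncard = k + 1 := by
  have hP : absNorm P = p := by
    have : P ∈ {P : Ideal S | absNorm P = p} := by rw [h]; simp
    exact this
  have hP' : absNorm P' = p := by
    have : P' ∈ {P : Ideal S | absNorm P = p} := by rw [h]; simp
    exact this
  have hP0 : P ≠ 0 := by
    rintro rfl
    exact hp.ne_zero (by simpa using hP.symm)
  have hP'0 : P' ≠ 0 := by
    rintro rfl
    exact hp.ne_zero (by simpa using hP'.symm)
  have hprime : Prime P := by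
    refine Ideal.prime_of_isPrime hP0 (isPrime_of_irreducible_absNorm ?_)
    rw [hP]
    exact hp
  have himg : {I : Ideal S | absNorm I = p ^ k} =
      (fun i => P ^ i * P' ^ (k - i)) '' (Finset.range (k + 1)) := by
    ext L
    simp only [Set.mem_ofPred_eq, Set.mem_image, Finset.coe_range, Set.mem_Iio]
    constructor
    · intro hL
      induction k generalizing L with
      | zero =>
        rw [pow_zero, absNorm_eq_one_iff] at hL
        exact ⟨0, one_pos, by simp [hL]⟩
      | succ k ih =>
        obtain ⟨Q, L', hQ, hL', rfl⟩ := exists_dvd_of_absNorm_eq_prime hrank hp hP hL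
        obtain ⟨i, hi, rfl⟩ := ih L' hL'
        have hQ' : Q ∈ {P : Ideal S | absNorm P = p} := hQ
        rw [h] at hQ'
        rcases hQ' with rfl | rfl
        · exact ⟨i + 1, by omega, by rw [Nat.add_sub_add_right, pow_succ', mul_assoc]⟩
        · exact ⟨i, by omega, by rw [Nat.sub_add_comm (by omega), pow_succ']; ring⟩
    · rintro ⟨i, hi, rfl⟩
      rw [map_mul, map_pow, map_pow, hP, hP', ← pow_add, Nat.add_sub_cancel' (by omega)]
  -- Were two products equal, cancelling `P ^ i` would make the prime `P` divide a power of `P'`,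
  -- hence equal `P'`.
  have hlt : ∀ i j, i < j → P ^ i * P' ^ (k - i) ≠ P ^ j * P' ^ (k - j) := by
    intro i j hij heq
    obtain ⟨l, rfl⟩ := Nat.exists_eq_add_of_lt hij
    rw [add_assoc, pow_add, mul_assoc] at heq
    have heq := mul_left_cancel₀ (pow_ne_zero i hP0) heq
    have hdvd : P ∣ P' ^ (k - i) := by
      rw [heq, pow_succ']
      exact (dvd_mul_right _ _).mul_right _
    exact hne (eq_of_dvd_of_absNorm_eq (hprime.dvd_of_dvd_pow hdvd) (hP.trans hP'.symm)
      (hP ▸ hp.ne_zero))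
  rw [himg, Set.InjOn.ncard_image, Set.ncard_coe_finset, Finset.card_range]
  intro i _ j _ hij
  rcases lt_trichotomy i j with hlt' | rfl | hlt'
  · exact absurd hij (hlt i j hlt')
  · rfl
  · exact absurd hij.symm (hlt j i hlt')

theorem Ideal.card_absNorm_prime_pow [CharZero S]
    (hrank : Module.finrank ℤ S = 2) (hp : p.Prime) {ε : ℤ} (hε : ε = 0 ∨ ε = 1 ∨ ε = -1)
    (h : (Nat.card {P : Ideal S // absNorm P = p} : ℤ) = 1 + ε) (k : ℕ) :
    (Nat.card {I : Ideal S // absNorm I = p ^ k} : ℤ) = ∑ i ∈ Finset.range (k + 1), ε ^ i := by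
  have hcoe : ∀ n, Nat.card {I : Ideal S // absNorm I = n} =
      {I : Ideal S | absNorm I = n}.ncard := fun n => Nat.card_coe_set_eq _
  rw [hcoe] at h ⊢
  rcases hε with rfl | rfl | rfl
  · have : {P : Ideal S | absNorm P = p}.ncard = 1 := by omega
    obtain ⟨P, hP⟩ := Set.ncard_eq_one.mp this
    rw [ncard_absNorm_prime_pow_of_ramified hrank hp hP, Finset.sum_range_succ']
    simp
  · have : {P : Ideal S | absNorm P = p}.ncard = 2 := by omega
    obtain ⟨P, P', hne, hP⟩ := Set.ncard_eq_two.mp this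
    rw [ncard_absNorm_prime_pow_of_split hrank hp hne hP]
    simp
  · have h0 : {P : Ideal S | absNorm P = p} = ∅ :=
      (Set.ncard_eq_zero (finite_setOfPred_absNorm_eq p)).mp (by omega)
    induction k using Nat.twoStepInduction with
    | zero =>
      have : {I : Ideal S | absNorm I = p ^ 0} = {⊤} := by ext; simp [absNorm_eq_one_iff]
      rw [this, Set.ncard_singleton]
      simp
    | one => simp [h0, Finset.sum_range_succ]
    | more k ih _ =>
      rw [ncard_absNorm_prime_pow_of_inert hrank hp h0, ih, Finset.sum_range_succ _ (k + 2),
        Finset.sum_range_succ _ (k + 1), pow_succ]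
      ring

end IdealCount

/-! ### Ideals of prime norm and roots modulo a prime -/

section PrimeIdeals

open NumberField

theorem absNorm_ker_eq {S : Type*} [CommRing S] [IsDedekindDomain S] [Module.Free ℤ S]
    {p : ℕ} (φ : S →+* ZMod p) : Ideal.absNorm (RingHom.ker φ) = p := by
  have e := RingHom.quotientKerEquivOfSurjective (ZMod.ringHom_surjective φ)
  rw [Ideal.absNorm_apply, Submodule.cardQuot_apply, Nat.card_congr e.toEquiv, Nat.card_zmod]

theorem exists_ker_eq_of_absNorm_eq {S : Type*} [CommRing S] [IsDedekindDomain S]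
    [Module.Free ℤ S] {p : ℕ} (hp : p.Prime) {I : Ideal S} (hI : Ideal.absNorm I = p) :
    ∃ φ : S →+* ZMod p, RingHom.ker φ = I := by
  rw [Ideal.absNorm_apply, Submodule.cardQuot_apply] at hI
  have : Finite (S ⧸ I) := Nat.finite_of_card_ne_zero (by rw [hI]; exact hp.ne_zero)
  have := Fintype.ofFinite (S ⧸ I)
  rw [Nat.card_eq_fintype_card] at hI
  refine ⟨((ZMod.ringEquivOfPrime (S ⧸ I) hp hI).symm : (S ⧸ I) →+* ZMod p).comp
    (Ideal.Quotient.mk I), ?_⟩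
  ext x
  simp [RingHom.mem_ker, Ideal.Quotient.eq_zero_iff_mem]

/-- Ideals of norm `p` are the kernels of ring maps to `ZMod p`, and such a map is determined by the
image of the generator `ω`. The kernel recovers that image `r`, since it contains `ω - n` for an
integer `n` lifting `r`. -/
theorem card_absNorm_eq_card_roots {S : Type*} [CommRing S] [IsDedekindDomain S]
    [Module.Free ℤ S] {a b : ℤ} (e : QuadraticAlgebra ℤ a b ≃ₐ[ℤ] S) {p : ℕ} (hp : p.Prime) :
    Nat.card {P : Ideal S // Ideal.absNorm P = p} =
      Nat.card {r : ZMod p // r * r = a • 1 + b • r} := by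
  symm
  have : Fact p.Prime := ⟨hp⟩
  have homega : ∀ r, QuadraticAlgebra.lift (R := ℤ) (A := ZMod p) (a := a) (b := b) r
      QuadraticAlgebra.omega = r := fun r => by simp [QuadraticAlgebra.lift]
  have hval : ∀ r (n : ℕ), QuadraticAlgebra.lift (R := ℤ) (A := ZMod p) (a := a) (b := b) r
      (e.symm (e (QuadraticAlgebra.omega - (n : QuadraticAlgebra ℤ a b)))) = r - n := fun r n => by
    rw [e.symm_apply_apply, map_sub, homega, map_natCast]
  refine Nat.card_congr (Equiv.ofBijective (fun r => ⟨RingHom.ker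
    ((QuadraticAlgebra.lift r).comp (e.symm : S →ₐ[ℤ] _) : S →+* ZMod p), absNorm_ker_eq _⟩)
      ⟨?_, ?_⟩)
  · intro r s h
    have h : RingHom.ker ((QuadraticAlgebra.lift r).comp (e.symm : S →ₐ[ℤ] _) : S →+* ZMod p) =
      RingHom.ker ((QuadraticAlgebra.lift s).comp (e.symm : S →ₐ[ℤ] _) : S →+* ZMod p) :=
      congrArg Subtype.val h
    have hmem : e (QuadraticAlgebra.omega - ((r.1.val : ℕ) : QuadraticAlgebra ℤ a b)) ∈ RingHom.ker
        ((QuadraticAlgebra.lift r).comp (e.symm : S →ₐ[ℤ] _) : S →+* ZMod p) := by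
      rw [RingHom.mem_ker]
      refine (hval r _).trans ?_
      simp
    rw [h, RingHom.mem_ker] at hmem
    have := (hval s _).symm.trans hmem
    rw [ZMod.natCast_zmod_val, sub_eq_zero] at this
    exact Subtype.ext this.symm
  · rintro ⟨I, hI⟩
    obtain ⟨φ, rfl⟩ := exists_ker_eq_of_absNorm_eq hp hI
    refine ⟨QuadraticAlgebra.lift.symm (φ.toIntAlgHom.comp (e : _ →ₐ[ℤ] S)), ?_⟩
    apply Subtype.ext
    simp only [Equiv.apply_symm_apply]
    congr 1
    ext x
    simp

theorem jacobiSym_neg_natCast_eq {p d : ℕ} (hp : Odd p) (h4 : d % 4 = 3) :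
    J(-(d : ℤ) | p) = J(p | d) := by
  rw [jacobiSym.neg _ hp]
  rcases Nat.odd_mod_four_iff.mp (Nat.odd_iff.mp hp) with h | h
  · rw [ZMod.χ₄_nat_one_mod_four h, one_mul,
      jacobiSym.quadratic_reciprocity_one_mod_four' (Nat.odd_iff.mpr (by omega)) h]
  · rw [ZMod.χ₄_nat_three_mod_four h, jacobiSym.quadratic_reciprocity_three_mod_four h4 h]
    ring

theorem card_roots_eq {d c p : ℕ} (hc : d + 1 = 4 * c) (hp : p.Prime) :
    (Nat.card {r : ZMod p // r * r = (-(c : ℤ)) • 1 + (1 : ℤ) • r} : ℤ) = 1 + J(p | d) := by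
  have no_root : ∀ r : ZMod 2, r * r ≠ 1 + r := by decide
  have : Fact p.Prime := ⟨hp⟩
  rcases hp.eq_two_or_odd' with rfl | hodd
  · have h2 := jacobiSym.at_two (b := d) (Nat.odd_iff.mpr (by omega))
    rw [Nat.cast_ofNat, h2, ZMod.χ₈_nat_eq_if_mod_eight]
    -- At `p = 2` the parity of `c` records whether `d` is `7` or `3` modulo `8`, that is, the value
    -- `J(2 | d)`.
    rcases Nat.even_or_odd c with h | h
    · have hc0 : (c : ZMod 2) = 0 := (ZMod.natCast_eq_zero_iff_even).mpr h
      rw [if_neg (by omega), if_pos (by obtain ⟨k, rfl⟩ := h; omega)]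
      simp [hc0]
      decide
    · have hc0 : (c : ZMod 2) = 1 := (ZMod.natCast_eq_one_iff_odd).mpr h
      rw [if_neg (by omega), if_neg (by obtain ⟨k, rfl⟩ := h; omega), Nat.card_eq_zero.mpr]
      · rfl
      · refine Or.inl ⟨fun ⟨r, hr⟩ => ?_⟩
        simp [hc0] at hr
        exact no_root r hr
  · have h2 : p ≠ 2 := by rintro rfl; exact absurd hodd (by decide)
    have h20 : (2 : ZMod p) ≠ 0 := by
      have := (ZMod.natCast_eq_zero_iff 2 p).not.mpr (fun h =>
        h2 ((Nat.prime_dvd_prime_iff_eq hp Nat.prime_two).mp h))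
      simpa using this
    have hs := legendreSym.card_sqrts p h2 (-(d : ℤ))
    rw [jacobiSym.legendreSym.to_jacobiSym, jacobiSym_neg_natCast_eq hodd (by omega)] at hs
    rw [add_comm, ← hs]
    norm_cast
    rw [Set.toFinset_card, ← Nat.card_eq_fintype_card]
    have hcd : (d : ZMod p) + 1 = 4 * c := by exact_mod_cast congrArg (Nat.cast : ℕ → ZMod p) hc
    -- Completing the square: `r ↦ 2r - 1` carries roots of `r² = r - c` to square roots of `-d`.
    refine Nat.card_congr (Equiv.subtypeEquiv
      (((Equiv.mulLeft₀ (2 : ZMod p) h20)).trans (Equiv.subRight 1)) fun r => ?_)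
    have hr : (Equiv.mulLeft₀ (2 : ZMod p) h20).trans (Equiv.subRight 1) r = 2 * r - 1 := rfl
    rw [hr, Set.mem_ofPred_eq]
    push_cast
    rw [zsmul_eq_mul, Int.cast_neg, Int.cast_natCast, mul_one, one_smul]
    have h40 : (4 : ZMod p) ≠ 0 := by
      rw [show (4 : ZMod p) = 2 * 2 by norm_num]
      exact mul_ne_zero h20 h20
    constructor
    · intro h
      linear_combination 4 * h + hcd
    · intro h
      apply mul_left_cancel₀ h40
      linear_combination h - hcd

end PrimeIdeals

/-! ### Factorisation of the Dedekind zeta function and Dirichlet's formula -/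

noncomputable section ClassNumberFormula

open NumberField Filter Topology

/-- The number of ideals of norm `n` (for `n ≠ 0`) in a Dedekind domain, as an arithmetic
function. -/
def idealCount (S : Type*) [CommRing S] [IsDedekindDomain S] [Module.Free ℤ S] :
    ArithmeticFunction ℤ :=
  toArithmeticFunction fun n => (Nat.card {I : Ideal S // Ideal.absNorm I = n} : ℤ)

theorem idealCount_apply (S : Type*) [CommRing S] [IsDedekindDomain S] [Module.Free ℤ S] {n : ℕ}
    (hn : n ≠ 0) : idealCount S n = Nat.card {I : Ideal S // Ideal.absNorm I = n} :=
  if_neg hn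

theorem idealCount_isMultiplicative (S : Type*) [CommRing S] [IsDedekindDomain S]
    [Module.Free ℤ S] [Module.Finite ℤ S] [CharZero S] : (idealCount S).IsMultiplicative := by
  refine ArithmeticFunction.IsMultiplicative.iff_ne_zero.2 ⟨?_, fun hm hn hmn => ?_⟩
  · rw [idealCount_apply _ one_ne_zero]
    simp [Ideal.absNorm_eq_one_iff]
  · rw [idealCount_apply _ (mul_ne_zero hm hn), idealCount_apply _ hm, idealCount_apply _ hn,
      Ideal.card_absNorm_mul hmn hm hn, Nat.cast_mul]

/-- The arithmetic function `n ↦ J(n | d)`. -/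
def jacobiArithmetic (d : ℕ) : ArithmeticFunction ℤ :=
  toArithmeticFunction fun n => J(n | d)

theorem jacobiArithmetic_apply (d : ℕ) {n : ℕ} (hn : n ≠ 0) : jacobiArithmetic d n = J(n | d) :=
  if_neg hn

theorem jacobiArithmetic_isMultiplicative (d : ℕ) : (jacobiArithmetic d).IsMultiplicative := by
  refine ArithmeticFunction.IsMultiplicative.iff_ne_zero.2 ⟨?_, fun hm hn _ => ?_⟩
  · rw [jacobiArithmetic_apply _ one_ne_zero, Nat.cast_one, jacobiSym.one_left]
  · rw [jacobiArithmetic_apply _ (mul_ne_zero hm hn), jacobiArithmetic_apply _ hm,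
      jacobiArithmetic_apply _ hn, Nat.cast_mul, jacobiSym.mul_left]

/-- Both sides are multiplicative, and at `p^k` both equal `∑_{i ≤ k} J(p | d)^i`. -/
theorem idealCount_imaginaryQuadraticField {d c : ℕ} (hd : Squarefree d) (hc : d + 1 = 4 * c) :
    idealCount (𝓞 (imaginaryQuadraticField d)) =
      (ζ : ArithmeticFunction ℤ) * jacobiArithmetic d := by
  rw [ArithmeticFunction.IsMultiplicative.eq_iff_eq_on_prime_powers _
    (idealCount_isMultiplicative _) _
    (ArithmeticFunction.isMultiplicative_zeta.natCast.mul (jacobiArithmetic_isMultiplicative d))]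
  intro p k hp
  have hrank : Module.finrank ℤ (𝓞 (imaginaryQuadraticField d)) = 2 := by
    rw [RingOfIntegers.rank, finrank_imaginaryQuadraticField hd hc]
  rw [idealCount_apply _ (pow_ne_zero k hp.ne_zero), ArithmeticFunction.coe_zeta_mul_apply,
    Nat.sum_divisors_prime_pow hp,
    Ideal.card_absNorm_prime_pow hrank hp (jacobiSym.trichotomy p d)
      (by rw [card_absNorm_eq_card_roots (quadraticAlgebraEquiv hd hc) hp, card_roots_eq hc hp])]
  refine Finset.sum_congr rfl fun i _ => ?_
  rw [jacobiArithmetic_apply _ (pow_ne_zero i hp.ne_zero), Nat.cast_pow, jacobiSym.pow_left]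

theorem dedekindZeta_imaginaryQuadraticField {d c : ℕ} [NeZero d] (hd : Squarefree d)
    (hc : d + 1 = 4 * c) {s : ℂ} (hs : 1 < s.re) :
    dedekindZeta (imaginaryQuadraticField d) s =
      riemannZeta s * DirichletCharacter.LFunction (jacobiChar d) s := by
  rw [DirichletCharacter.LFunction_eq_LSeries _ hs, ← LSeries_one_eq_riemannZeta hs,
    ← LSeries_convolution' (LSeriesSummable_one_iff.mpr hs)
      (ZMod.LSeriesSummable_of_one_lt_re (jacobiChar d) hs), dedekindZeta]
  refine LSeries_congr (fun {n} hn => ?_) s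
  have h := congrArg (Int.cast : ℤ → ℂ)
    (DFunLike.congr_fun (idealCount_imaginaryQuadraticField hd hc) n)
  rw [idealCount_apply _ hn, ArithmeticFunction.coe_zeta_mul_apply, Int.cast_natCast] at h
  rw [h, LSeries.convolution_def, Int.cast_sum]
  refine Eq.trans ?_ (Nat.sum_divisorsAntidiagonal'
    (fun a b => (1 : ℕ → ℂ) a * (jacobiChar d) (b : ZMod d))).symm
  refine Finset.sum_congr rfl fun m hm => ?_
  rw [jacobiArithmetic_apply _ (Nat.pos_of_mem_divisors hm).ne', jacobiChar_natCast]
  simp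

/-- Multiply the factorisation by `s - 1` and let `s → 1⁺`: zeta contributes residue `1`, and `L` is
continuous at `1` because the character is nontrivial. -/
theorem LFunction_jacobiChar_one_eq_residue {d c : ℕ} [NeZero d] (hd : Squarefree d)
    (hc : d + 1 = 4 * c) :
    DirichletCharacter.LFunction (jacobiChar d) 1 =
      (dedekindZeta_residue (imaginaryQuadraticField d) : ℂ) := by
  have hof : Tendsto (fun s : ℝ => (s : ℂ)) (𝓝[>] 1) (𝓝[≠] 1) := by
    refine tendsto_nhdsWithin_iff.mpr ⟨?_, ?_⟩
    · exact (Complex.continuous_ofReal.tendsto' 1 1 Complex.ofReal_one).mono_left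
        nhdsWithin_le_nhds
    · filter_upwards [self_mem_nhdsWithin] with s hs
      have : s ≠ 1 := ne_of_gt hs
      simpa using this
  have hL : Tendsto (fun s : ℝ => DirichletCharacter.LFunction (jacobiChar d) s) (𝓝[>] 1)
      (𝓝 (DirichletCharacter.LFunction (jacobiChar d) 1)) :=
    ((DirichletCharacter.differentiable_LFunction (jacobiChar_ne_one
      (Nat.odd_iff.mpr (by omega)) hd (by omega))).continuous.tendsto 1).comp
      (hof.mono_right nhdsWithin_le_nhds)
  have h := (riemannZeta_residue_one.comp hof).mul hL
  rw [one_mul] at h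
  refine tendsto_nhds_unique (h.congr' ?_)
    (tendsto_sub_one_mul_dedekindZeta_nhdsGT (imaginaryQuadraticField d))
  filter_upwards [self_mem_nhdsWithin] with s hs
  rw [dedekindZeta_imaginaryQuadraticField hd hc (by simpa using hs)]
  simp [mul_assoc]

theorem sum_range_mul_jacobi_eq_classNumber {d : ℕ} (hd : Squarefree d) (h4 : d % 4 = 3) :
    ((∑ b ∈ Finset.range d, (b : ℤ) * J(b | d) : ℤ) : ℝ) =
      -(d * (classWeight d * classNumberNeg d)) := by
  have hc : d + 1 = 4 * ((d + 1) / 4) := by omega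
  have : NeZero d := ⟨hd.ne_zero⟩
  have h := (LFunction_jacobiChar_one hd h4).symm.trans (LFunction_jacobiChar_one_eq_residue hd hc)
  rw [dedekindZeta_residue_imaginaryQuadraticField hd hc, Complex.ofReal_inj] at h
  have hd0 : (0 : ℝ) < d := by exact_mod_cast hd.ne_zero.bot_lt
  have hs := Real.sq_sqrt hd0.le
  have hs0 := Real.sqrt_pos.mpr hd0
  generalize ((∑ b ∈ Finset.range d, (b : ℤ) * J(b | d) : ℤ) : ℝ) = A at h ⊢
  generalize classWeight d * classNumberNeg d = B at h ⊢
  have hpi := Real.pi_pos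
  field_simp at h
  rw [hs] at h
  apply mul_left_cancel₀ hd0.ne'
  linarith

end ClassNumberFormula

theorem mainTheorem8 (N : ℕ) (hN : Squarefree N) :
    (latticePointCount parabolicRegion (N : ℝ) : ℝ)
        - (MeasureTheory.volume parabolicRegion).toReal * (N : ℝ) ^ 2
      = 7 / 3 - 4 * ∑ d ∈ N.divisors.filter (fun d => d % 4 = 3),
          classWeight d * (classNumberNeg d : ℝ) :=
  latticePointCount_sub_volume_of_classNumberFormula N hN
    fun _ hd h4 => sum_range_mul_jacobi_eq_classNumber hd h4
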